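/- Let $M$ be a monoid and $W\subseteq M$ a submonoid. Regard $M$ as a category with one object, in which the arrow $f$ followed by the arrow $g$ is $fg$. **Hammock localization.** A *hammock of height $n$ and length $m\ge 0$* in $(M,W)$ is a commutative diagram with $n+1$ rows, each a zigzag of $m$ horizontal arrows, in which every interior position carries vertical arrows pointing from each row to the next (at the two ends the vertical arrows are identities). In each column all horizontal arrows point in the same direction, and all vertical and all left-pointing arrows lie in $W$. It is *reduced* if adjacent columns point in different directions and no column consists of identities only. Every hammock is reduced by repeatedly composing adjacent columns of equal direction and deleting identity columns. $L^H_W(M)$ is the simplicial monoid whose $n$-simplices are the reduced hammocks of height $n$; faces and degeneracies delete (composing the adjacent vertical arrows) or repeat a row and then reduce, the product $xy$ is the concatenation $x$ followed by $y$ (with a column of vertical identities at the point of gluing), reduced, and the unit is the hammock of length $0$. **Operads.** Operads are symmetric operads in sets with compositions $\gamma(x;y_1,\dots,y_k)$. The operad $M_+$ has $M_+(0)=\{*\}$, $M_+(1)=M$ and $M_+(k)=\emptyset$ for $k\ge 2$, with $\gamma(x;y)=xy$ for $x,y\in M$. The unary operations of an operad form a monoid with $x\cdot y=\gamma(x;y)$.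 **Tree hammock localization.** Let $\mathscr O$ be an operad and $\mathcal W\subseteq\mathscr O(1)$ a submonoid. Consider finite planar rooted trees with $k$ leaves labelled bijectively by $1,\dots,k$, glued from pieces $O_j\colon 1\to j$ ($j\ge 0$; $O_0$ has no outgoing node) and $W_1\colon 1\leftarrow 1$; the tree consisting of a single labelled node is allowed. A *tree hammock of height $n$ and arity $k$* consists of $n+1$ parallel copies of such a tree, where each piece $O_j$ in each copy carries an element of $\mathscr O(j)$, each piece $W_1$ in each copy carries an element of $\mathcal W$, and every node carries vertical arrows in $\mathcal W$ from each copy to the next, which are identities at the root and at the labelled leaves. It has to commute: for a column of pieces $O_j$ labelled $\alpha$ and $\alpha'$ in two consecutive copies, with vertical arrows $v$ at its source node and $b_1,\dots,b_j$ at its target nodes, $\gamma(\alpha;b_1,\dots,b_j)=\gamma(v;\alpha')$; for a column of pieces $W_1$ labelled $w$ and $w'$, with vertical arrows $v$ at the node towards the root and $b$ at the other node, $\gamma(w;v)=\gamma(b;w')$. It is *reduced* if adjacent pieces point in different directions and no column of pieces $O_1$ or $W_1$ is labelled by identities only. Every tree hammock is reduced by repeatedly composing adjacent columns of equal direction and deleting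 identity columns. The reduced tree hammocks of height $n$ form an operad: the symmetric groups relabel the leaves, the composition is grafting followed by reduction, and the unit is the one-node tree. Deleting (composing the adjacent vertical arrows) or repeating a copy, followed by reduction, makes these operads a simplicial operad $L^{TH}_{\mathcal W}(\mathscr O)$. In particular $L^{TH}_{\mathcal W}(\mathscr O)(1)$ is a simplicial monoid. **Lemma.** There is an isomorphism of simplicial monoids $$L^H_W(M)\;\cong\;L^{TH}_W(M_+)(1),$$ where on the right $W\subseteq M=M_+(1)$. Thus the Dwyer–Kan hammock localization of $M$ with respect to $W$ agrees with the arity-one part of the tree hammock localization of $M_+$ with respect to $W$. -/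

import Mathlib

open CategoryTheory

universe u v

namespace HammockLocalization

/-! ### The hammock localization of a category -/

section Hammocks

variable {C : Type u} [Category.{v} C]

/-- A node of a hammock of height `n`: the vertical chain `k₀ ⟶ k₁ ⟶ ⋯ ⟶ kₙ` of arrows of `W`
(with all their composites), that is a functor from the poset `{0 < ⋯ < n}` of rows. -/
structure VertChain (W : MorphismProperty C) (n : ℕ) where
  toFunctor : Fin (n + 1) ⥤ C
  mem : ∀ {i j : Fin (n + 1)} (f : i ⟶ j), W (toFunctor.map f)

variable {W : MorphismProperty C}

/-- The vertical chain all of whose arrows are the identity of `a`. -/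
def VertChain.const [W.ContainsIdentities] (n : ℕ) (a : C) : VertChain W n where
  toFunctor := (Functor.const _).obj a
  mem _ := W.id_mem a

/-- Deleting and repeating rows of a vertical chain, along a monotone map of the sets of rows. -/
def VertChain.reindex {m n : ℕ} (θ : Fin (m + 1) →o Fin (n + 1)) (X : VertChain W n) :
    VertChain W m where
  toFunctor := θ.monotone.functor ⋙ X.toFunctor
  mem f := X.mem (θ.monotone.functor.map f)

/-- Deleting and repeating rows of a column of horizontal arrows. -/
def VertChain.reindexHom {m n : ℕ} (θ : Fin (m + 1) →o Fin (n + 1)) {X Y : VertChain W n}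
    (f : X.toFunctor ⟶ Y.toFunctor) : (X.reindex θ).toFunctor ⟶ (Y.reindex θ).toFunctor :=
  Functor.whiskerLeft θ.monotone.functor f

/-- A (not necessarily reduced) hammock of height `n` from one vertical chain to another: a finite
sequence of columns of horizontal arrows.  In a column all arrows point to the right (`right`), or
they all point to the left and lie in `W` (`left`); naturality is the commutativity of the
diagram. -/
inductive Hammock (W : MorphismProperty C) (n : ℕ) :
    VertChain W n → VertChain W n → Type (max u v)
  | nil (X : VertChain W n) : Hammock W n X X
  | right {X Y Z : VertChain W n} (f : X.toFunctor ⟶ Y.toFunctor) (h : Hammock W n Y Z) :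
      Hammock W n X Z
  | left {X Y Z : VertChain W n} (f : Y.toFunctor ⟶ X.toFunctor) (hf : ∀ i, W (f.app i))
      (h : Hammock W n Y Z) : Hammock W n X Z

namespace Hammock

/-- A column of horizontal arrows contains only identity maps. -/
def IsIdentityColumn {n : ℕ} {X Y : VertChain W n} (f : X.toFunctor ⟶ Y.toFunctor) : Prop :=
  ∀ i, ∃ e : X.toFunctor.obj i = Y.toFunctor.obj i, f.app i = eqToHom e

theorem IsIdentityColumn.eq {n : ℕ} {X Y : VertChain W n} {f : X.toFunctor ⟶ Y.toFunctor}
    (h : IsIdentityColumn f) : X = Y := by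
  obtain ⟨F, hF⟩ := X
  obtain ⟨G, hG⟩ := Y
  have : F = G := by
    refine CategoryTheory.Functor.ext (fun i => (h i).1) fun i j a => ?_
    have := f.naturality a
    obtain ⟨e, he⟩ := h i
    obtain ⟨e', he'⟩ := h j
    dsimp only at he he' this
    rw [he, he'] at this
    rw [← Category.assoc, ← this]
    simp
  subst this
  rfl

theorem isIdentityColumn_id {n : ℕ} (X : VertChain W n) :
    IsIdentityColumn (X := X) (Y := X) (𝟙 X.toFunctor) := fun _ => ⟨rfl, rfl⟩

theorem IsIdentityColumn.eq_id {n : ℕ} {X : VertChain W n} {f : X.toFunctor ⟶ X.toFunctor}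
    (h : IsIdentityColumn (X := X) (Y := X) f) : f = 𝟙 _ := by
  ext i
  obtain ⟨_, he⟩ := h i
  simpa using he

/-- The first column points to the right. -/
def StartsRight {n : ℕ} {X Y : VertChain W n} : Hammock W n X Y → Prop
  | nil _ => False
  | right _ _ => True
  | left _ _ _ => False

/-- The first column points to the left. -/
def StartsLeft {n : ℕ} {X Y : VertChain W n} : Hammock W n X Y → Prop
  | nil _ => False
  | right _ _ => False
  | left _ _ _ => True

/-- A hammock is reduced if arrows in adjacent columns point in different directions and no column
contains only identity maps. -/
def IsReduced {n : ℕ} {X Y : VertChain W n} : Hammock W n X Y → Prop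
  | nil _ => True
  | right f h => ¬ IsIdentityColumn f ∧ ¬ h.StartsRight ∧ h.IsReduced
  | left f _ h => ¬ IsIdentityColumn f ∧ ¬ h.StartsLeft ∧ h.IsReduced

/-- Concatenation of hammocks. -/
def append {n : ℕ} {X Y Z : VertChain W n} : Hammock W n X Y → Hammock W n Y Z → Hammock W n X Z
  | nil _, k => k
  | right f h, k => right f (append h k)
  | left f hf h, k => left f hf (append h k)

/-- Deleting and repeating rows of a hammock, along a monotone map of the sets of rows. -/
def reindex {m n : ℕ} (θ : Fin (m + 1) →o Fin (n + 1)) {X Y : VertChain W n} :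
    Hammock W n X Y → Hammock W m (X.reindex θ) (Y.reindex θ)
  | nil X => nil (X.reindex θ)
  | right f h => right (VertChain.reindexHom θ f) (h.reindex θ)
  | left f hf h =>
      left (VertChain.reindexHom θ f) (fun i => hf (θ i)) (h.reindex θ)

open Classical in
/-- Put a right-pointing column in front of a hammock, unless it contains only identity maps. -/
noncomputable def consRight {n : ℕ} {X Y Z : VertChain W n} (f : X.toFunctor ⟶ Y.toFunctor)
    (h : Hammock W n Y Z) : Hammock W n X Z :=
  if hf : IsIdentityColumn f then hf.eq ▸ h else right f h

open Classical in
/-- Put a left-pointing column in front of a hammock, unless it contains only identity maps. -/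
noncomputable def consLeft {n : ℕ} {X Y Z : VertChain W n} (f : Y.toFunctor ⟶ X.toFunctor)
    (hf : ∀ i, W (f.app i)) (h : Hammock W n Y Z) : Hammock W n X Z :=
  if hi : IsIdentityColumn f then hi.eq ▸ h else left f hf h

/-- Put a right-pointing column in front of a reduced hammock and reduce: compose it with the first
column if that points to the right too, and delete the result if it contains only identities. -/
noncomputable def pushRight {n : ℕ} {X Y Z : VertChain W n} (f : X.toFunctor ⟶ Y.toFunctor)
    (h : Hammock W n Y Z) : Hammock W n X Z :=
  match h with
  | nil _ => consRight f (nil _)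
  | right f' h' => consRight (f ≫ f') h'
  | left g hg h' => consRight f (left g hg h')

/-- Put a left-pointing column in front of a reduced hammock and reduce. -/
noncomputable def pushLeft [W.IsMultiplicative] {n : ℕ} {X Y Z : VertChain W n}
    (f : Y.toFunctor ⟶ X.toFunctor) (hf : ∀ i, W (f.app i)) (h : Hammock W n Y Z) :
    Hammock W n X Z :=
  match h with
  | nil _ => consLeft f hf (nil _)
  | right g h' => consLeft f hf (right g h')
  | left f' hf' h' => consLeft (f' ≫ f) (fun i => W.comp_mem _ _ (hf' i) (hf i)) h'

/-- The reduced form of a hammock: compose adjacent columns pointing in the same direction and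
delete columns of identities, until this is no longer possible. -/
noncomputable def reduce [W.IsMultiplicative] {n : ℕ} {X Y : VertChain W n} :
    Hammock W n X Y → Hammock W n X Y
  | nil X => nil X
  | right f h => pushRight f h.reduce
  | left f hf h => pushLeft f hf h.reduce

/-! Reduction is well defined and compatible with the operations. -/

section Lemmas

variable {n : ℕ} {X Y Z : VertChain W n}

theorem consRight_id (h : Hammock W n X Y) : consRight (𝟙 X.toFunctor) h = h :=
  dif_pos (isIdentityColumn_id X)

theorem consLeft_id (hf) (h : Hammock W n X Y) : consLeft (𝟙 X.toFunctor) hf h = h :=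
  dif_pos (isIdentityColumn_id X)

theorem consRight_isReduced (f : X.toFunctor ⟶ Y.toFunctor) {h : Hammock W n Y Z}
    (hs : ¬ h.StartsRight) (hr : h.IsReduced) : (consRight f h).IsReduced := by
  by_cases hf : IsIdentityColumn f
  · obtain rfl := hf.eq
    obtain rfl := hf.eq_id
    rwa [consRight_id]
  · rw [consRight, dif_neg hf]
    exact ⟨hf, hs, hr⟩

theorem consLeft_isReduced (f : Y.toFunctor ⟶ X.toFunctor) (hW) {h : Hammock W n Y Z}
    (hs : ¬ h.StartsLeft) (hr : h.IsReduced) : (consLeft f hW h).IsReduced := by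
  by_cases hf : IsIdentityColumn f
  · obtain rfl := hf.eq
    obtain rfl := hf.eq_id
    rwa [consLeft_id]
  · rw [consLeft, dif_neg hf]
    exact ⟨hf, hs, hr⟩

theorem pushRight_isReduced (f : X.toFunctor ⟶ Y.toFunctor) {h : Hammock W n Y Z}
    (hr : h.IsReduced) : (pushRight f h).IsReduced := by
  cases h with
  | nil => exact consRight_isReduced f (fun h => h) trivial
  | right f' h' => exact consRight_isReduced _ hr.2.1 hr.2.2
  | left g hg h' => exact consRight_isReduced f (fun h => h) hr

theorem pushRight_of_not (f : X.toFunctor ⟶ Y.toFunctor) {h : Hammock W n Y Z}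
    (hs : ¬ h.StartsRight) : pushRight f h = consRight f h := by
  cases h with
  | nil => rfl
  | right f' h' => exact absurd trivial hs
  | left g hg h' => rfl

theorem pushRight_id {h : Hammock W n X Z} (hr : h.IsReduced) :
    pushRight (𝟙 X.toFunctor) h = h := by
  cases h with
  | nil => exact consRight_id _
  | right f' h' =>
    show consRight (𝟙 _ ≫ f') h' = _
    rw [Category.id_comp, consRight, dif_neg hr.1]
  | left g hg h' => exact consRight_id _

theorem pushRight_comp {T : VertChain W n} (f : T.toFunctor ⟶ X.toFunctor)
    (g : X.toFunctor ⟶ Y.toFunctor) {h : Hammock W n Y Z} (hr : h.IsReduced) :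
    pushRight (f ≫ g) h = pushRight f (pushRight g h) := by
  have key : ∀ {X Y : VertChain W n} (f : T.toFunctor ⟶ X.toFunctor)
      (g : X.toFunctor ⟶ Y.toFunctor) {h : Hammock W n Y Z} (hs : ¬ h.StartsRight),
      consRight (f ≫ g) h = pushRight f (consRight g h) := by
    intro X Y f g h hs
    by_cases hg : IsIdentityColumn g
    · obtain rfl := hg.eq
      obtain rfl := hg.eq_id
      rw [consRight_id, Category.comp_id, pushRight_of_not f hs]
    · rw [consRight.eq_1 g, dif_neg hg]
      rfl
  cases h with
  | nil => exact key f g (fun h => h)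
  | right f' h' =>
    show consRight ((f ≫ g) ≫ f') h' = pushRight f (consRight (g ≫ f') h')
    rw [Category.assoc]
    exact key f (g ≫ f') hr.2.1
  | left k hk h' => exact key f g (fun h => h)

theorem append_assoc {T : VertChain W n} (h : Hammock W n X Y) (k : Hammock W n Y Z)
    (l : Hammock W n Z T) : (h.append k).append l = h.append (k.append l) := by
  induction h with
  | nil => rfl
  | right f h ih => simp only [append, ih]
  | left f hf h ih => simp only [append, ih]

theorem append_nil (h : Hammock W n X Y) : h.append (nil Y) = h := by
  induction h with
  | nil => rfl
  | right f h ih => simp only [append, ih]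
  | left f hf h ih => simp only [append, ih]

theorem reindex_append {m : ℕ} (θ : Fin (m + 1) →o Fin (n + 1)) (h : Hammock W n X Y) (k : Hammock W n Y Z) :
    (h.append k).reindex θ = (h.reindex θ).append (k.reindex θ) := by
  induction h with
  | nil => rfl
  | right f h ih => simp only [append, reindex, ih]
  | left f hf h ih => simp only [append, reindex, ih]

theorem reindex_id (h : Hammock W n X Y) : h.reindex OrderHom.id = h := by
  induction h with
  | nil => rfl
  | right f h ih => simp only [reindex]; erw [ih]; rfl
  | left f hf h ih => simp only [reindex]; erw [ih]; rfl

theorem reindex_comp {m : ℕ} (θ : Fin (m + 1) →o Fin (n + 1)) {l : ℕ} (φ : Fin (l + 1) →o Fin (m + 1)) (h : Hammock W n X Y) :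
    h.reindex (θ.comp φ) = (h.reindex θ).reindex φ := by
  induction h with
  | nil => rfl
  | right f h ih => simp only [reindex]; erw [ih]; rfl
  | left f hf h ih => simp only [reindex]; erw [ih]; rfl

variable [W.IsMultiplicative]

theorem pushLeft_isReduced (f : Y.toFunctor ⟶ X.toFunctor) (hf) {h : Hammock W n Y Z}
    (hr : h.IsReduced) : (pushLeft f hf h).IsReduced := by
  cases h with
  | nil => exact consLeft_isReduced f hf (fun h => h) trivial
  | left f' _ h' => exact consLeft_isReduced _ _ hr.2.1 hr.2.2
  | right g h' => exact consLeft_isReduced f hf (fun h => h) hr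

theorem pushLeft_of_not (f : Y.toFunctor ⟶ X.toFunctor) (hf) {h : Hammock W n Y Z}
    (hs : ¬ h.StartsLeft) : pushLeft f hf h = consLeft f hf h := by
  cases h with
  | nil => rfl
  | left f' _ h' => exact absurd trivial hs
  | right g h' => rfl

theorem pushLeft_id (hf) {h : Hammock W n X Z} (hr : h.IsReduced) :
    pushLeft (𝟙 X.toFunctor) hf h = h := by
  cases h with
  | nil => exact consLeft_id hf _
  | left f' _ h' =>
    show consLeft (f' ≫ 𝟙 _) _ h' = _
    simp only [Category.comp_id]
    rw [consLeft, dif_neg hr.1]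
  | right g h' => exact consLeft_id hf _

theorem pushLeft_comp {T : VertChain W n} (f : X.toFunctor ⟶ T.toFunctor)
    (hf : ∀ i, W (f.app i)) (g : Y.toFunctor ⟶ X.toFunctor) (hg : ∀ i, W (g.app i))
    (hfg : ∀ i, W ((g ≫ f).app i)) {h : Hammock W n Y Z} (hr : h.IsReduced) :
    pushLeft (g ≫ f) hfg h = pushLeft f hf (pushLeft g hg h) := by
  have key : ∀ {X Y : VertChain W n} (f : X.toFunctor ⟶ T.toFunctor)
      (hf : ∀ i, W (f.app i)) (g : Y.toFunctor ⟶ X.toFunctor) (hg : ∀ i, W (g.app i))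
      (hfg : ∀ i, W ((g ≫ f).app i)) {h : Hammock W n Y Z} (hs : ¬ h.StartsLeft),
      consLeft (g ≫ f) hfg h = pushLeft f hf (consLeft g hg h) := by
    intro X Y f _ g hgW _ h hs
    by_cases hg : IsIdentityColumn g
    · obtain rfl := hg.eq
      obtain rfl := hg.eq_id
      simp only [consLeft_id, Category.id_comp, pushLeft_of_not f _ hs]
    · rw [consLeft.eq_1 g, dif_neg hg]
      rfl
  cases h with
  | nil => exact key f hf g hg hfg (fun h => h)
  | left f' hf' h' =>
    have := key f hf (f' ≫ g) (fun i => W.comp_mem _ _ (hf' i) (hg i)) (fun i => by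
      simpa using W.comp_mem _ _ (hf' i) (hfg i)) hr.2.1
    simp only [Category.assoc] at this
    exact this
  | right k h' => exact key f hf g hg hfg (fun h => h)

theorem reduce_isReduced (h : Hammock W n X Y) : h.reduce.IsReduced := by
  induction h with
  | nil => trivial
  | right f h ih => exact pushRight_isReduced f ih
  | left f hf h ih => exact pushLeft_isReduced f hf ih

theorem reduce_eq_self {h : Hammock W n X Y} (hr : h.IsReduced) : h.reduce = h := by
  induction h with
  | nil => rfl
  | right f h ih =>
    rw [reduce, ih hr.2.2, pushRight_of_not f hr.2.1, consRight, dif_neg hr.1]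
  | left f hf h ih =>
    rw [reduce, ih hr.2.2, pushLeft_of_not f hf hr.2.1, consLeft, dif_neg hr.1]

theorem reduce_append_right (h : Hammock W n X Y) (k : Hammock W n Y Z) :
    (h.append k.reduce).reduce = (h.append k).reduce := by
  induction h with
  | nil => exact reduce_eq_self (reduce_isReduced k)
  | right f h ih => simp only [append, reduce, ih]
  | left f hf h ih => simp only [append, reduce, ih]

theorem append_pushRight (f : X.toFunctor ⟶ Y.toFunctor) {T : VertChain W n}
    (h : Hammock W n Y Z) (k : Hammock W n Z T) :
    ((pushRight f h).append k).reduce = pushRight f (h.append k).reduce := by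
  have key : ∀ {X Y : VertChain W n} (f : X.toFunctor ⟶ Y.toFunctor) (h : Hammock W n Y Z),
      ((consRight f h).append k).reduce = pushRight f (h.append k).reduce := by
    intro X Y f h
    by_cases hf : IsIdentityColumn f
    · obtain rfl := hf.eq
      obtain rfl := hf.eq_id
      rw [consRight_id, pushRight_id (reduce_isReduced _)]
    · rw [consRight, dif_neg hf]
      rfl
  cases h with
  | nil => exact key _ _
  | right f' h' =>
    refine (key _ _).trans ?_
    rw [pushRight_comp _ _ (reduce_isReduced _)]
    rfl
  | left g hg h' => exact key _ _

theorem append_pushLeft (f : Y.toFunctor ⟶ X.toFunctor) (hf) {T : VertChain W n}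
    (h : Hammock W n Y Z) (k : Hammock W n Z T) :
    ((pushLeft f hf h).append k).reduce = pushLeft f hf (h.append k).reduce := by
  have key : ∀ {X Y : VertChain W n} (f : Y.toFunctor ⟶ X.toFunctor) (hf) (h : Hammock W n Y Z),
      ((consLeft f hf h).append k).reduce = pushLeft f hf (h.append k).reduce := by
    intro X Y f hfW h
    by_cases hf : IsIdentityColumn f
    · obtain rfl := hf.eq
      obtain rfl := hf.eq_id
      rw [consLeft_id, pushLeft_id _ (reduce_isReduced _)]
    · rw [consLeft, dif_neg hf]
      rfl
  cases h with
  | nil => exact key _ _ _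
  | left f' hf' h' =>
    refine (key _ (fun i => W.comp_mem _ _ (hf' i) (hf i)) _).trans ?_
    exact pushLeft_comp f hf f' hf' _ (reduce_isReduced _)
  | right g h' => exact key _ _ _

theorem reduce_append_left (h : Hammock W n X Y) (k : Hammock W n Y Z) :
    (h.reduce.append k).reduce = (h.append k).reduce := by
  induction h with
  | nil => rfl
  | right f h ih => rw [reduce, append_pushRight, ih]; rfl
  | left f hf h ih => rw [reduce, append_pushLeft, ih]; rfl

variable {m : ℕ} (θ : Fin (m + 1) →o Fin (n + 1))

theorem reindex_pushRight (f : X.toFunctor ⟶ Y.toFunctor) (h : Hammock W n Y Z) :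
    ((pushRight f h).reindex θ).reduce =
      pushRight (X := X.reindex θ) (Y := Y.reindex θ)
        (VertChain.reindexHom θ f) (h.reindex θ).reduce := by
  have key : ∀ {X Y : VertChain W n} (f : X.toFunctor ⟶ Y.toFunctor) (h : Hammock W n Y Z),
      ((consRight f h).reindex θ).reduce =
      pushRight (X := X.reindex θ) (Y := Y.reindex θ)
        (VertChain.reindexHom θ f) (h.reindex θ).reduce := by
    intro X Y f h
    by_cases hf : IsIdentityColumn f
    · obtain rfl := hf.eq
      obtain rfl := hf.eq_id
      rw [consRight_id]
      exact (pushRight_id (reduce_isReduced _)).symm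
    · rw [consRight, dif_neg hf]
      rfl
  cases h with
  | nil => exact key _ _
  | right f' h' =>
    refine (key _ _).trans ?_
    exact pushRight_comp (T := X.reindex θ) (X := Y.reindex θ)
      (VertChain.reindexHom θ f) (VertChain.reindexHom θ f')
      (reduce_isReduced _)
  | left g hg h' => exact key _ _

theorem reindex_pushLeft (f : Y.toFunctor ⟶ X.toFunctor) (hf : ∀ i, W (f.app i))
    (h : Hammock W n Y Z) :
    ((pushLeft f hf h).reindex θ).reduce =
      pushLeft (X := X.reindex θ) (Y := Y.reindex θ)
        (VertChain.reindexHom θ f) (fun i => hf (θ i)) (h.reindex θ).reduce := by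
  have key : ∀ {X Y : VertChain W n} (f : Y.toFunctor ⟶ X.toFunctor) (hf : ∀ i, W (f.app i))
      (h : Hammock W n Y Z),
      ((consLeft f hf h).reindex θ).reduce =
      pushLeft (X := X.reindex θ) (Y := Y.reindex θ)
        (VertChain.reindexHom θ f) (fun i => hf (θ i)) (h.reindex θ).reduce := by
    intro X Y f hfW h
    by_cases hf : IsIdentityColumn f
    · obtain rfl := hf.eq
      obtain rfl := hf.eq_id
      rw [consLeft_id]
      exact (pushLeft_id _ (reduce_isReduced _)).symm
    · rw [consLeft, dif_neg hf]
      rfl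
  cases h with
  | nil => exact key _ _ _
  | left f' hf' h' =>
    refine (key _ (fun i => W.comp_mem _ _ (hf' i) (hf i)) _).trans ?_
    exact pushLeft_comp (T := X.reindex θ) (X := Y.reindex θ)
      (VertChain.reindexHom θ f) (fun i => hf (θ i)) (VertChain.reindexHom θ f')
      (fun i => hf' (θ i)) (fun i => W.comp_mem _ _ (hf' (θ i)) (hf (θ i))) (reduce_isReduced _)
  | right g h' => exact key _ _ _

theorem reduce_reindex (h : Hammock W n X Y) :
    (h.reduce.reindex θ).reduce = (h.reindex θ).reduce := by
  induction h with
  | nil => rfl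
  | right f h ih => rw [reduce, reindex_pushRight, ih]; rfl
  | left f hf h ih => rw [reduce, reindex_pushLeft, ih]; rfl

end Lemmas

end Hammock

variable (W) [W.IsMultiplicative]

/-- The reduced hammocks of height `n` from the object `a` to the object `b`. -/
def ReducedHammock (n : ℕ) (a b : C) : Type (max u v) :=
  {h : Hammock W n (VertChain.const n a) (VertChain.const n b) // h.IsReduced}

namespace ReducedHammock

variable {W} {n : ℕ}

/-- The reduced hammock of length zero. -/
def id (n : ℕ) (a : C) : ReducedHammock W n a a := ⟨.nil _, trivial⟩

/-- Composition: concatenation of hammocks, followed by reduction. -/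
noncomputable def comp {a b c : C} (h : ReducedHammock W n a b) (k : ReducedHammock W n b c) :
    ReducedHammock W n a c :=
  ⟨(h.1.append k.1).reduce, Hammock.reduce_isReduced _⟩

/-- Deleting and repeating rows, followed by reduction. -/
noncomputable def reindex {m : ℕ} (θ : Fin (m + 1) →o Fin (n + 1)) {a b : C}
    (h : ReducedHammock W n a b) : ReducedHammock W m a b :=
  ⟨(h.1.reindex θ).reduce, Hammock.reduce_isReduced _⟩

theorem id_comp {a b : C} (h : ReducedHammock W n a b) : comp (id n a) h = h :=
  Subtype.ext (Hammock.reduce_eq_self h.2)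

theorem comp_id {a b : C} (h : ReducedHammock W n a b) : comp h (id n b) = h :=
  Subtype.ext ((congrArg _ (Hammock.append_nil h.1)).trans (Hammock.reduce_eq_self h.2))

theorem assoc {a b c d : C} (h : ReducedHammock W n a b) (k : ReducedHammock W n b c)
    (l : ReducedHammock W n c d) : comp (comp h k) l = comp h (comp k l) :=
  Subtype.ext (by
    simp only [comp, Hammock.reduce_append_left, Hammock.reduce_append_right,
      Hammock.append_assoc])

theorem reindex_nat_id {a b : C} (h : ReducedHammock W n a b) : h.reindex OrderHom.id = h :=
  Subtype.ext ((congrArg _ (Hammock.reindex_id h.1)).trans (Hammock.reduce_eq_self h.2))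

theorem reindex_nat_comp {l m : ℕ} (θ : Fin (m + 1) →o Fin (n + 1))
    (φ : Fin (l + 1) →o Fin (m + 1)) {a b : C} (h : ReducedHammock W n a b) :
    h.reindex (θ.comp φ) = (h.reindex θ).reindex φ :=
  Subtype.ext ((congrArg _ (Hammock.reindex_comp θ φ h.1)).trans
    (Hammock.reduce_reindex φ _).symm)

theorem reindex_unit {m : ℕ} (θ : Fin (m + 1) →o Fin (n + 1)) (a : C) :
    (id (W := W) n a).reindex θ = id m a := rfl

theorem reindex_mul {m : ℕ} (θ : Fin (m + 1) →o Fin (n + 1)) {a b c : C}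
    (h : ReducedHammock W n a b) (k : ReducedHammock W n b c) :
    (comp h k).reindex θ = comp (h.reindex θ) (k.reindex θ) :=
  Subtype.ext (by
    simp only [comp, reindex, Hammock.reduce_reindex, Hammock.reindex_append]
    erw [Hammock.reduce_append_left, Hammock.reduce_append_right]
    rfl)

end ReducedHammock

/-- The `n`-simplices of the endomorphisms of `a` in the hammock localization form a monoid, with
`x * y` the composite of `x` followed by `y` (concatenation in the order in which it is read). -/
noncomputable instance (n : ℕ) (a : C) : Monoid (ReducedHammock W n a a) where
  mul h k := h.comp k
  one := ReducedHammock.id n a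
  mul_assoc := ReducedHammock.assoc
  one_mul := ReducedHammock.id_comp
  mul_one := ReducedHammock.comp_id

/-- The simplicial monoid `L^H_W C (a, a)` of endomorphisms of `a` in the hammock localization. -/
noncomputable def hammockEnd (a : C) : SimplicialObject MonCat.{max u v} where
  obj n := MonCat.of (ReducedHammock W n.unop.len a a)
  map θ := MonCat.ofHom
    { toFun := ReducedHammock.reindex θ.unop.toOrderHom
      map_one' := ReducedHammock.reindex_unit _ _
      map_mul' := ReducedHammock.reindex_mul _ }
  map_id n := by
    ext h
    exact ReducedHammock.reindex_nat_id h
  map_comp f g := by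
    ext h
    exact ReducedHammock.reindex_nat_comp f.unop.toOrderHom g.unop.toOrderHom h

end Hammocks


/-! ### Operads in sets -/

section Blocks

/-- The bijection of `∑ s, j s` onto `∑ t, j (e⁻¹ t)` that moves the `s`-th block to the place
`e s`. -/
def blockEquiv {m k : ℕ} (e : Fin m ≃ Fin k) (j : Fin m → ℕ) :
    Fin (∑ s, j s) ≃ Fin (∑ t, j (e.symm t)) :=
  (finSigmaFinEquiv.symm.trans (Equiv.sigmaCongrLeft' (β := fun s => Fin (j s)) e)).trans
    finSigmaFinEquiv

/-- The block sum of bijections. -/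
def sumEquiv {k : ℕ} {i j : Fin k → ℕ} (τ : ∀ s, Fin (i s) ≃ Fin (j s)) :
    Fin (∑ s, i s) ≃ Fin (∑ s, j s) :=
  (finSigmaFinEquiv.symm.trans (Equiv.sigmaCongrRight τ)).trans finSigmaFinEquiv

end Blocks

/-- A (symmetric) operad in the category of sets.  Since `Fin m ≃ Fin n` is empty for `m ≠ n`, the
operation `act` is just a right action of the symmetric group on `Op n` for each `n`; in this form
it needs no identification of `Op m` with `Op n` for equal numbers `m` and `n`. -/
structure SetOperad : Type (u + 1) where
  Op : ℕ → Type u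
  one : Op 1
  act {m n : ℕ} (e : Fin m ≃ Fin n) (x : Op n) : Op m
  γ {k : ℕ} {j : Fin k → ℕ} (x : Op k) (y : ∀ s, Op (j s)) : Op (∑ s, j s)
  act_refl {n : ℕ} (x : Op n) : act (Equiv.refl _) x = x
  act_trans {l m n : ℕ} (e : Fin l ≃ Fin m) (f : Fin m ≃ Fin n) (x : Op n) :
    act (e.trans f) x = act e (act f x)
  γ_assoc {k : ℕ} {j : Fin k → ℕ} {i : ∀ s, Fin (j s) → ℕ} (x : Op k) (y : ∀ s, Op (j s))
    (z : ∀ s t, Op (i s t)) :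
    (⟨_, γ (γ x y) (fun p => z (finSigmaFinEquiv.symm p).1 (finSigmaFinEquiv.symm p).2)⟩ :
      Σ n, Op n) = ⟨_, γ x (fun s => γ (y s) (z s))⟩
  one_γ {n : ℕ} (x : Op n) :
    (⟨_, γ one (fun _ => x)⟩ : Σ n, Op n) = ⟨n, x⟩
  γ_one {n : ℕ} (x : Op n) :
    (⟨_, γ x (fun _ => one)⟩ : Σ n, Op n) = ⟨n, x⟩
  act_γ {m k : ℕ} (e : Fin m ≃ Fin k) {j : Fin m → ℕ} (x : Op k) (y : ∀ s, Op (j s)) :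
    γ (act e x) y = act (blockEquiv e j) (γ x (fun t => y (e.symm t)))
  γ_act {k : ℕ} {i j : Fin k → ℕ} (x : Op k) (τ : ∀ s, Fin (i s) ≃ Fin (j s))
    (y : ∀ s, Op (j s)) :
    γ x (fun s => act (τ s) (y s)) = act (sumEquiv τ) (γ x y)

namespace SetOperad

/-- A morphism of operads. -/
@[ext]
structure Hom (O P : SetOperad.{u}) where
  map {n : ℕ} (x : O.Op n) : P.Op n
  map_one : map O.one = P.one
  map_act {m n : ℕ} (e : Fin m ≃ Fin n) (x : O.Op n) : map (O.act e x) = P.act e (map x)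
  map_γ {k : ℕ} {j : Fin k → ℕ} (x : O.Op k) (y : ∀ s, O.Op (j s)) :
    map (O.γ x y) = P.γ (map x) (fun s => map (y s))

instance : Category SetOperad.{u} where
  Hom := Hom
  id O := ⟨fun x => x, rfl, fun _ _ => rfl, fun _ _ => rfl⟩
  comp f g := ⟨fun x => g.map (f.map x), by rw [f.map_one, g.map_one],
    fun e x => by rw [f.map_act, g.map_act], fun x y => by rw [f.map_γ, g.map_γ]⟩

section Unary

variable (O : SetOperad.{u})

theorem act_finCongr {m n : ℕ} (h : m = n) (x : O.Op n) :
    (⟨m, O.act (finCongr h) x⟩ : Σ n, O.Op n) = ⟨n, x⟩ := by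
  subst h
  exact congrArg (Sigma.mk m) (O.act_refl x)

/-- Composition of operations of unspecified arity. -/
def comp (p : Σ n, O.Op n) (f : Fin p.1 → Σ n, O.Op n) : Σ n, O.Op n :=
  ⟨_, O.γ p.2 (fun s => (f s).2)⟩

/-- The composite of two one-ary operations. -/
def mul (x y : O.Op 1) : O.Op 1 :=
  O.act (finCongr (by simp)) (O.γ x (fun _ => y))

theorem comp_assoc (p : Σ n, O.Op n) (f : Fin p.1 → Σ n, O.Op n)
    (g : ∀ s, Fin (f s).1 → Σ n, O.Op n) :
    O.comp (O.comp p f) (fun q => g (finSigmaFinEquiv.symm q).1 (finSigmaFinEquiv.symm q).2) =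
      O.comp p (fun s => O.comp (f s) (g s)) :=
  O.γ_assoc p.2 (fun s => (f s).2) (fun s t => (g s t).2)

theorem comp_one (p : Σ n, O.Op n) : O.comp p (fun _ => ⟨1, O.one⟩) = p :=
  O.γ_one p.2

theorem one_comp (f : Fin 1 → Σ n, O.Op n) : O.comp ⟨1, O.one⟩ f = f 0 := by
  have h : f = fun _ => f 0 := funext fun s => congrArg f (Subsingleton.elim s 0)
  rw [h]
  exact O.one_γ (f 0).2

theorem mk_mul (x y : O.Op 1) :
    (⟨1, O.mul x y⟩ : Σ n, O.Op n) = O.comp ⟨1, x⟩ (fun _ => ⟨1, y⟩) :=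
  O.act_finCongr _ _

theorem sigma_inj {n : ℕ} {x y : O.Op n} (h : (⟨n, x⟩ : Σ n, O.Op n) = ⟨n, y⟩) : x = y :=
  eq_of_heq (Sigma.mk.inj h).2

/-- The one-ary operations of an operad form a monoid, with `x * y = γ (x; y)`. -/
instance unaryMonoid : Monoid (O.Op 1) where
  mul := O.mul
  one := O.one
  mul_assoc x y z := O.sigma_inj (by
    change (⟨1, O.mul (O.mul x y) z⟩ : Σ n, O.Op n) = ⟨1, O.mul x (O.mul y z)⟩
    rw [mk_mul, mk_mul, mk_mul, mk_mul]
    exact O.γ_assoc (i := fun _ _ => 1) x (fun _ => y) (fun _ _ => z))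
  one_mul x := O.sigma_inj ((O.mk_mul _ _).trans (O.one_γ x))
  mul_one x := O.sigma_inj ((O.mk_mul _ _).trans (O.γ_one x))

end Unary

/-- A morphism of operads induces a morphism of the monoids of one-ary operations. -/
def Hom.unary {O P : SetOperad.{u}} (f : Hom O P) : O.Op 1 →* P.Op 1 where
  toFun x := f.map x
  map_one' := f.map_one
  map_mul' x _ := (f.map_act _ _).trans (congrArg _ (f.map_γ x _))

/-- The functor that sends an operad to its monoid of one-ary operations. -/
def unary : SetOperad.{u} ⥤ MonCat.{u} where
  obj O := MonCat.of (O.Op 1)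
  map f := MonCat.ofHom (Hom.unary f)

end SetOperad

/-! ### The operad of a monoid -/

section MonoidOperad

variable (M : Type u)

/-- The sets of operations of the operad `M₊` of a monoid `M`: a point in arity zero, `M` in arity
one, and nothing in higher arities. -/
def PlusOp : ℕ → Type u
  | 0 => PUnit
  | 1 => M
  | _ + 2 => PEmpty

variable {M}

/-- An element of `M` as a one-ary operation of `M₊`. -/
def PlusOp.of (a : M) : PlusOp M 1 := a

/-- The unique action of the symmetric groups on `M₊`, which is trivial. -/
def PlusOp.act {m n : ℕ} (e : Fin m ≃ Fin n) (x : PlusOp M n) : PlusOp M m :=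
  cast (congrArg (PlusOp M) (Fin.equiv_iff_eq.1 ⟨e⟩).symm) x

/-- Left multiplication by `a` on `M₊(n)`: the multiplication of `M` for `n = 1`, and the identity
of the one-point set for `n = 0`. -/
def PlusOp.smul [Monoid M] (a : M) : ∀ {n : ℕ}, PlusOp M n → PlusOp M n
  | 0, _ => PUnit.unit
  | 1, b => show M from a * (show M from b)
  | _ + 2, b => b

/-- The composition of the operad `M₊`. -/
def PlusOp.γ [Monoid M] : ∀ {k : ℕ} {j : Fin k → ℕ} (_ : PlusOp M k) (_ : ∀ s, PlusOp M (j s)),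
    PlusOp M (∑ s, j s)
  | 0, j, _, _ => cast (congrArg (PlusOp M) (Fin.sum_univ_zero j).symm) (PUnit.unit : PlusOp M 0)
  | 1, j, a, y => cast (congrArg (PlusOp M) (Fin.sum_univ_one j).symm) (PlusOp.smul (show M from a) (y 0))
  | _ + 2, _, x, _ => PEmpty.elim x

/-- The element of `M` underlying an operation, if it is one-ary. -/
def PlusOp.val : ∀ {n : ℕ}, PlusOp M n → Option M
  | 0, _ => none
  | 1, a => some a
  | _ + 2, x => PEmpty.elim x

theorem PlusOp.val_inj : ∀ {m n : ℕ} {x : PlusOp M m} {y : PlusOp M n}, x.val = y.val →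
    (⟨m, x⟩ : Σ n, PlusOp M n) = ⟨n, y⟩
  | 0, 0, _, _, _ => rfl
  | 1, 1, _, _, h => by cases h; rfl
  | 0, 1, _, _, h => by cases h
  | 1, 0, _, _, h => by cases h
  | _ + 2, _, x, _, _ => PEmpty.elim x
  | _, _ + 2, _, y, _ => PEmpty.elim y

theorem PlusOp.val_inj' {n : ℕ} {x y : PlusOp M n} (h : x.val = y.val) : x = y :=
  eq_of_heq (Sigma.mk.inj (PlusOp.val_inj h)).2

theorem PlusOp.val_cast {m n : ℕ} (h : m = n) (x : PlusOp M m) :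
    (cast (congrArg (PlusOp M) h) x).val = x.val := by
  subst h
  rfl

theorem PlusOp.val_smul [Monoid M] (a : M) : ∀ {n : ℕ} (x : PlusOp M n),
    (x.smul a).val = x.val.map (fun b => a * b)
  | 0, _ => rfl
  | 1, _ => rfl
  | _ + 2, x => PEmpty.elim x

theorem PlusOp.eq_of_fin : ∀ {k : ℕ} (_ : PlusOp M k) (s s' : Fin k), s = s'
  | 0, _, s, _ => s.elim0
  | 1, _, _, _ => Subsingleton.elim _ _
  | _ + 2, x, _, _ => PEmpty.elim x

theorem PlusOp.val_γ_none [Monoid M] : ∀ {k : ℕ} {j : Fin k → ℕ} {x : PlusOp M k}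
    (y : ∀ s, PlusOp M (j s)) (_ : x.val = none), (PlusOp.γ x y).val = none
  | 0, j, _, _, _ => PlusOp.val_cast (Fin.sum_univ_zero j).symm (PUnit.unit : PlusOp M 0)
  | 1, _, _, _, h => by cases h
  | _ + 2, _, x, _, _ => PEmpty.elim x

theorem PlusOp.val_γ_some [Monoid M] : ∀ {k : ℕ} {j : Fin k → ℕ} {x : PlusOp M k}
    (y : ∀ s, PlusOp M (j s)) {a : M} (_ : x.val = some a) (s : Fin k),
    (PlusOp.γ x y).val = (y s).val.map (fun b => a * b)
  | 0, _, _, _, _, h, _ => by cases h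
  | 1, j, x, y, a, h, s => by
    obtain rfl : x = PlusOp.of a := Option.some.inj h
    rw [Subsingleton.elim s 0]
    exact (PlusOp.val_cast (Fin.sum_univ_one j).symm _).trans (PlusOp.val_smul _ (y 0))
  | _ + 2, _, x, _, _, _, _ => PEmpty.elim x

theorem PlusOp.arity_of_some : ∀ {k : ℕ} {x : PlusOp M k} {a : M}, x.val = some a → k = 1
  | 0, _, _, h => by cases h
  | 1, _, _, _ => rfl
  | _ + 2, x, _, _ => PEmpty.elim x

theorem PlusOp.val_act {m n : ℕ} (e : Fin m ≃ Fin n) (x : PlusOp M n) :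
    (PlusOp.act e x).val = x.val :=
  PlusOp.val_cast (Fin.equiv_iff_eq.1 ⟨e⟩).symm x

variable (M)

/-- The operad `M₊` of a monoid `M`; composition is the multiplication of `M`. -/
def plusOperad [Monoid M] : SetOperad.{u} where
  Op := PlusOp M
  one := PlusOp.of 1
  act := PlusOp.act
  γ := PlusOp.γ
  act_refl _ := rfl
  act_trans e f x := PlusOp.val_inj' (by simp only [PlusOp.val_act])
  γ_assoc {k j i} x y z := PlusOp.val_inj (by
    cases hx : x.val with
    | none => rw [PlusOp.val_γ_none _ (PlusOp.val_γ_none y hx), PlusOp.val_γ_none _ hx]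
    | some a =>
      have hk := PlusOp.arity_of_some hx
      have s : Fin k := ⟨0, by omega⟩
      have hxy := PlusOp.val_γ_some y hx s
      rw [PlusOp.val_γ_some _ hx s]
      cases hy : (y s).val with
      | none =>
        rw [hy] at hxy
        rw [PlusOp.val_γ_none _ hxy, PlusOp.val_γ_none _ hy]
        rfl
      | some b =>
        have hj := PlusOp.arity_of_some hy
        have t : Fin (j s) := ⟨0, by omega⟩
        rw [hy] at hxy
        rw [PlusOp.val_γ_some _ hxy (finSigmaFinEquiv ⟨s, t⟩), PlusOp.val_γ_some _ hy t,
          Equiv.symm_apply_apply, Option.map_map]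
        congr 1
        funext c
        exact mul_assoc a b c)
  one_γ x := PlusOp.val_inj (by
    refine (PlusOp.val_γ_some (x := PlusOp.of (1 : M)) (fun _ => x) rfl 0).trans ?_
    cases x.val with
    | none => rfl
    | some a => exact congrArg some (one_mul a))
  γ_one {n} x := PlusOp.val_inj (by
    cases hx : x.val with
    | none => rw [PlusOp.val_γ_none _ hx]
    | some a =>
      have hk := PlusOp.arity_of_some hx
      rw [PlusOp.val_γ_some _ hx ⟨0, by omega⟩]
      exact congrArg some (mul_one a))
  act_γ {m k} e j x y := PlusOp.val_inj' (by
    rw [PlusOp.val_act]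
    cases hx : x.val with
    | none => rw [PlusOp.val_γ_none _ hx, PlusOp.val_γ_none _ ((PlusOp.val_act e x).trans hx)]
    | some a =>
      have hk := PlusOp.arity_of_some hx
      have t : Fin k := ⟨0, by omega⟩
      rw [PlusOp.val_γ_some _ hx t, PlusOp.val_γ_some _ ((PlusOp.val_act e x).trans hx) (e.symm t)])
  γ_act {k _ _} x τ y := PlusOp.val_inj' (by
    rw [PlusOp.val_act]
    cases hx : x.val with
    | none => rw [PlusOp.val_γ_none _ hx, PlusOp.val_γ_none _ hx]
    | some a =>
      have hk := PlusOp.arity_of_some hx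
      have s : Fin k := ⟨0, by omega⟩
      rw [PlusOp.val_γ_some _ hx s, PlusOp.val_γ_some _ hx s, PlusOp.val_act])

/-- The identification of `M` with the monoid of one-ary operations of `M₊`. -/
def plusUnary [Monoid M] : M ≃* (plusOperad M).Op 1 where
  toFun a := PlusOp.of a
  invFun x := (show M from x)
  left_inv _ := rfl
  right_inv _ := rfl
  map_mul' a b := PlusOp.val_inj' (M := M) (n := 1)
    ((PlusOp.val_act (finCongr (by simp)) _).trans
      (PlusOp.val_γ_some (x := PlusOp.of a) (fun _ => PlusOp.of b) rfl 0)).symm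

end MonoidOperad


/-! ### Tree hammocks -/

/-- The vertical chain of height `n` over a node: the composite `hom` of the vertical arrows from
row `i` down to row `j`, for all `i ≤ j`.  It is determined by the arrows between consecutive
rows. -/
@[ext]
structure Chain (S : Type u) [Monoid S] (n : ℕ) where
  hom {i j : Fin (n + 1)} (h : i ≤ j) : S
  hom_refl (i : Fin (n + 1)) : hom (le_refl i) = 1
  hom_trans {i j k : Fin (n + 1)} (h : i ≤ j) (h' : j ≤ k) : hom (h.trans h') = hom h * hom h'

namespace Chain

variable {S : Type u} [Monoid S]

/-- The vertical chain of identities. -/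
def triv (n : ℕ) : Chain S n := ⟨fun _ => 1, fun _ => rfl, fun _ _ => (one_mul 1).symm⟩

/-- Deleting and repeating rows. -/
def reindex {m n : ℕ} (θ : Fin (m + 1) →o Fin (n + 1)) (v : Chain S n) : Chain S m :=
  ⟨fun h => v.hom (θ.monotone h), fun i => v.hom_refl (θ i),
    fun h h' => v.hom_trans (θ.monotone h) (θ.monotone h')⟩

end Chain

/-- A column of `n + 1` operations of an operad, of the same arity, with its children. -/
structure Node (O : SetOperad.{u}) (n : ℕ) (X : Type u) where
  arity : ℕ
  op : Fin (n + 1) → O.Op arity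
  child : Fin arity → X

namespace Node

variable {O : SetOperad.{u}} {n : ℕ} {X Y Z : Type u}

theorem ext' {p q : Node O n X} (h : p.arity = q.arity)
    (hop : ∀ i, (⟨p.arity, p.op i⟩ : Σ n, O.Op n) = ⟨q.arity, q.op i⟩)
    (hch : ∀ s, p.child s = q.child (Fin.cast h s)) : p = q := by
  obtain ⟨k, α, c⟩ := p
  obtain ⟨k', α', c'⟩ := q
  dsimp only at h hop hch
  subst h
  obtain rfl : α = α' := funext fun i => eq_of_heq (Sigma.mk.inj (hop i)).2
  obtain rfl : c = c' := funext hch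
  rfl

/-- The column of identities. -/
def pure (x : X) : Node O n X := ⟨1, fun _ => O.one, fun _ => x⟩

/-- Composition of a column with columns that are its children. -/
def bind (p : Node O n X) (f : X → Node O n Y) : Node O n Y where
  arity := ∑ s, (f (p.child s)).arity
  op i := O.γ (p.op i) (fun s => (f (p.child s)).op i)
  child q := (f (p.child (finSigmaFinEquiv.symm q).1)).child (finSigmaFinEquiv.symm q).2

/-- Deleting and repeating rows, and applying a function to the children. -/
def map {m : ℕ} (θ : Fin (m + 1) →o Fin (n + 1)) (g : X → Y) (p : Node O n X) : Node O m Y :=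
  ⟨p.arity, fun i => p.op (θ i), fun s => g (p.child s)⟩

/-- All the operations of the column are the identity of the operad. -/
def IsIdentity (p : Node O n X) : Prop :=
  ∀ i, (⟨p.arity, p.op i⟩ : Σ n, O.Op n) = ⟨1, O.one⟩

theorem IsIdentity.arity_eq {p : Node O n X} (h : p.IsIdentity) : p.arity = 1 :=
  congrArg Sigma.fst (h 0)

/-- The only child of a column of identities. -/
def IsIdentity.only {p : Node O n X} (h : p.IsIdentity) : X :=
  p.child ⟨0, by rw [h.arity_eq]; exact Nat.one_pos⟩

theorem isIdentity_pure (x : X) : (pure x : Node O n X).IsIdentity := fun _ => rfl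

theorem IsIdentity.eq_pure {p : Node O n X} (h : p.IsIdentity) : p = pure h.only :=
  ext' h.arity_eq h fun s => congrArg p.child (Fin.ext (by
    have := h.arity_eq
    have := s.2
    dsimp only
    omega))

end Node

/-! The identification of blocks of blocks. -/

theorem finSigmaFinEquiv_lt {k : ℕ} {j : Fin k → ℕ} {a b : Σ s, Fin (j s)}
    (h : a.1 < b.1 ∨ ∃ e : a.1 = b.1, (Fin.cast (congrArg j e) a.2) < b.2) :
    finSigmaFinEquiv a < finSigmaFinEquiv b := by
  have key : ∀ a : Σ s, Fin (j s), (finSigmaFinEquiv a : ℕ) =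
      ∑ i ∈ Finset.range a.1, (if h : i < k then j ⟨i, h⟩ else 0) + a.2 := by
    intro a
    rw [finSigmaFinEquiv_apply, Finset.sum_range]
    congr 1
    refine Finset.sum_congr rfl fun i _ => ?_
    rw [dif_pos (i.2.trans a.1.2)]
    rfl
  obtain ⟨a, a'⟩ := a
  obtain ⟨b, b'⟩ := b
  rw [Fin.lt_def, key, key]
  rcases h with h | ⟨e, h⟩
  · have h1 : ∑ i ∈ Finset.range (a + 1), (if h : i < k then j ⟨i, h⟩ else 0) ≤
        ∑ i ∈ Finset.range b, (if h : i < k then j ⟨i, h⟩ else 0) :=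
      Finset.sum_le_sum_of_subset (Finset.range_mono h)
    rw [Finset.sum_range_succ, dif_pos a.2] at h1
    have := a'.2
    dsimp only at this ⊢
    simp only [Fin.eta] at h1
    omega
  · dsimp only at e
    subst e
    exact Nat.add_lt_add_left h _

theorem strictMono_val_eq {a b : ℕ} (h : a = b) (f : Fin a → Fin b) (hf : StrictMono f)
    (i : Fin a) : f i = Fin.cast h i := by
  subst h
  let e := hf.orderIsoOfSurjective f (Finite.surjective_of_injective hf.injective)
  have : e = OrderIso.refl _ := Subsingleton.elim _ _
  exact congrArg (fun e : Fin a ≃o Fin a => e i) this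

theorem sum_blocks {k : ℕ} {j : Fin k → ℕ} (i : ∀ s, Fin (j s) → ℕ) :
    ∑ q : Fin (∑ s, j s), i (finSigmaFinEquiv.symm q).1 (finSigmaFinEquiv.symm q).2 =
      ∑ s, ∑ t, i s t := by
  rw [← Fintype.sum_sigma (f := fun x : Σ s, Fin (j s) => i x.1 x.2)]
  exact Fintype.sum_equiv finSigmaFinEquiv.symm _ _ fun _ => rfl

theorem block_assoc {k : ℕ} {j : Fin k → ℕ} (i : ∀ s, Fin (j s) → ℕ)
    (q : Fin (∑ s, j s))
    (c : Fin (i (finSigmaFinEquiv.symm q).1 (finSigmaFinEquiv.symm q).2)) :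
    finSigmaFinEquiv ⟨(finSigmaFinEquiv.symm q).1,
        finSigmaFinEquiv ⟨(finSigmaFinEquiv.symm q).2, c⟩⟩ =
      Fin.cast (sum_blocks i)
        (finSigmaFinEquiv (n := fun q => i (finSigmaFinEquiv.symm q).1
          (finSigmaFinEquiv.symm q).2) ⟨q, c⟩) := by
  let F : (Σ q : Fin (∑ s, j s), Fin (i (finSigmaFinEquiv.symm q).1
      (finSigmaFinEquiv.symm q).2)) → Fin (∑ s, ∑ t, i s t) := fun x =>
    finSigmaFinEquiv ⟨(finSigmaFinEquiv.symm x.1).1,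
        finSigmaFinEquiv ⟨(finSigmaFinEquiv.symm x.1).2, x.2⟩⟩
  have hlex : ∀ {k : ℕ} {j : Fin k → ℕ} {a b : Σ s, Fin (j s)},
      finSigmaFinEquiv a < finSigmaFinEquiv b →
      a.1 < b.1 ∨ ∃ e : a.1 = b.1, (Fin.cast (congrArg j e) a.2) < b.2 := by
    intro k j a b h
    obtain ⟨a, a'⟩ := a
    obtain ⟨b, b'⟩ := b
    rcases lt_trichotomy a b with hab | rfl | hab
    · exact Or.inl hab
    · refine Or.inr ⟨rfl, ?_⟩
      by_contra hc
      rcases (not_lt.1 hc).lt_or_eq with hc | hc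
      · exact lt_asymm h (finSigmaFinEquiv_lt (Or.inr ⟨rfl, hc⟩))
      · obtain rfl : b' = a' := hc
        exact lt_irrefl _ h
    · exact absurd h (lt_asymm (finSigmaFinEquiv_lt (Or.inl hab)))
  have aux : ∀ (x x' : Σ s, Fin (j s)) (c : Fin (i x.1 x.2)) (c' : Fin (i x'.1 x'.2)),
      finSigmaFinEquiv x < finSigmaFinEquiv x' →
      (finSigmaFinEquiv ⟨x.1, finSigmaFinEquiv ⟨x.2, c⟩⟩ : Fin (∑ s, ∑ t, i s t)) <
        finSigmaFinEquiv ⟨x'.1, finSigmaFinEquiv ⟨x'.2, c'⟩⟩ := by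
    rintro ⟨s, t⟩ ⟨s', t'⟩ c c' h
    rcases hlex h with h | ⟨e, h⟩
    · exact finSigmaFinEquiv_lt (Or.inl h)
    · dsimp only at e
      subst e
      exact finSigmaFinEquiv_lt (Or.inr ⟨rfl, finSigmaFinEquiv_lt (Or.inl h)⟩)
  have hF : StrictMono (fun y => F (finSigmaFinEquiv.symm y)) := by
    intro y y' hy
    obtain ⟨x, rfl⟩ := finSigmaFinEquiv.surjective y
    obtain ⟨x', rfl⟩ := finSigmaFinEquiv.surjective y'
    simp only [Equiv.symm_apply_apply]
    obtain ⟨q, c⟩ := x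
    obtain ⟨q', c'⟩ := x'
    rcases hlex hy with h | ⟨e, h⟩
    · dsimp only at h
      exact aux _ _ c c' (by rwa [Equiv.apply_symm_apply, Equiv.apply_symm_apply])
    · dsimp only at e
      subst e
      exact finSigmaFinEquiv_lt (Or.inr ⟨rfl, finSigmaFinEquiv_lt (Or.inr ⟨rfl, h⟩)⟩)
  have := strictMono_val_eq (sum_blocks i) _ hF (finSigmaFinEquiv ⟨q, c⟩)
  rw [← this]
  simp only [Equiv.symm_apply_apply]
  rfl

namespace Node

variable {O : SetOperad.{u}} {n : ℕ} {X Y Z : Type u}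

theorem child_bind (p : Node O n X) (f : X → Node O n Y)
    (y : Σ s, Fin (f (p.child s)).arity) :
    (p.bind f).child (finSigmaFinEquiv y) = (f (p.child y.1)).child y.2 :=
  congrArg (fun y : Σ s, Fin (f (p.child s)).arity => (f (p.child y.1)).child y.2)
    (finSigmaFinEquiv.symm_apply_apply y)

theorem bind_ext {p : Node O n X} {f : X → Node O n Y} {q : Node O n Y}
    (h : (p.bind f).arity = q.arity)
    (hop : ∀ i, (⟨_, O.γ (p.op i) (fun s => (f (p.child s)).op i)⟩ : Σ n, O.Op n) =
      ⟨q.arity, q.op i⟩)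
    (hch : ∀ y : Σ s, Fin (f (p.child s)).arity,
      (f (p.child y.1)).child y.2 = q.child (Fin.cast h (finSigmaFinEquiv y))) :
    p.bind f = q :=
  ext' h hop fun s => by
    obtain ⟨y, rfl⟩ := finSigmaFinEquiv.surjective s
    exact (child_bind p f y).trans (hch y)

theorem pure_bind (x : X) (f : X → Node O n Y) : (pure x).bind f = f x :=
  bind_ext (Fin.sum_univ_one (fun _ => (f x).arity)) (fun i => O.one_γ ((f x).op i)) fun y =>
    congrArg (f x).child (Fin.ext (finSigmaFinEquiv_one y).symm)

theorem val_finSigmaFinEquiv_const {k : ℕ} (y : Σ _ : Fin k, Fin 1) :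
    (finSigmaFinEquiv y : ℕ) = y.1 := by
  rw [finSigmaFinEquiv_apply]
  have := y.2.2
  simp

theorem bind_pure (p : Node O n X) : p.bind pure = p :=
  bind_ext (by simp [bind, pure]) (fun i => O.γ_one (p.op i)) fun y =>
    congrArg p.child (Fin.ext (val_finSigmaFinEquiv_const y).symm)

theorem bind_assoc (p : Node O n X) (f : X → Node O n Y) (g : Y → Node O n Z) :
    (p.bind f).bind g = p.bind (fun x => (f x).bind g) := by
  refine bind_ext (sum_blocks fun s t => (g ((f (p.child s)).child t)).arity)
    (fun i => O.γ_assoc (p.op i) (fun s => (f (p.child s)).op i)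
      (fun s t => (g ((f (p.child s)).child t)).op i)) fun y => ?_
  refine Eq.trans ?_ (congrArg (p.bind fun x => (f x).bind g).child
    (block_assoc (fun s t => (g ((f (p.child s)).child t)).arity) y.1 y.2))
  refine Eq.trans ?_ (child_bind p (fun x => (f x).bind g)
    ⟨(finSigmaFinEquiv.symm y.1).1, finSigmaFinEquiv ⟨(finSigmaFinEquiv.symm y.1).2, y.2⟩⟩).symm
  exact (child_bind (f (p.child (finSigmaFinEquiv.symm y.1).1)) g
    ⟨(finSigmaFinEquiv.symm y.1).2, y.2⟩).symm

end Node


section Trees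

variable {O : SetOperad.{u}} {W : Submonoid (O.Op 1)}

/-- A diagram of `n + 1` parallel copies of a planar tree, glued from atomic pieces
`O_k : 1 → k` (`op`) and `W_1 : 1 ← 1` (`inv`), with leaves labelled in `L` (`leaf`).  Every node
carries a chain of vertical arrows in `W`; those at a labelled leaf are identities.  A piece `op`
carries in each row an operation of arity `k`, and a piece `inv` an element of `W`.  The root node
of each child is glued to the corresponding leaf node of the piece.  The pieces `O_0 : 1 → 0` have
no leaf nodes. -/
inductive TreeDiagram (O : SetOperad.{u}) (W : Submonoid (O.Op 1)) (n : ℕ) (L : Type) : Type u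
  | leaf (l : L)
  | op (v : Chain W n) (k : ℕ) (α : Fin (n + 1) → O.Op k) (child : Fin k → TreeDiagram O W n L)
  | inv (v : Chain W n) (w : Fin (n + 1) → W) (child : TreeDiagram O W n L)

namespace TreeDiagram

/-- The vertical chain at the root node. -/
def rootChain {n : ℕ} {L : Type} : TreeDiagram O W n L → Chain W n
  | leaf _ => Chain.triv n
  | op v _ _ _ => v
  | inv v _ _ => v

/-- The diagram commutes.  For a piece `O_k : 1 → k` with root chain `v`, leaf chains `b₁, …, b_k`
and operations `αᵢ`, this means `γ (αᵢ; b₁, …, b_k) = γ (v; αⱼ)` for all rows `i ≤ j`, where `v`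
and `b_s` stand for the vertical arrows from row `i` to row `j`; for a piece `W_1 : 1 ← 1` with
root chain `v`, leaf chain `b` and arrows `wᵢ` from the leaf to the root, it means
`γ (wᵢ; v) = γ (b; wⱼ)`. -/
def IsCommutative {n : ℕ} {L : Type} : TreeDiagram O W n L → Prop
  | leaf _ => True
  | op v _ α c =>
      (∀ (i j : Fin (n + 1)) (h : i ≤ j),
        (⟨_, O.γ (α i) (fun s => ((c s).rootChain.hom h : O.Op 1))⟩ : Σ n, O.Op n) =
          ⟨_, O.γ (v.hom h : O.Op 1) (fun _ => α j)⟩) ∧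
      ∀ s, (c s).IsCommutative
  | inv v w t =>
      (∀ (i j : Fin (n + 1)) (h : i ≤ j), w i * v.hom h = t.rootChain.hom h * w j) ∧
      t.IsCommutative

/-- The number of times that the label `l` occurs. -/
def count {n : ℕ} {L : Type} [DecidableEq L] (l : L) : TreeDiagram O W n L → ℕ
  | leaf l' => if l' = l then 1 else 0
  | op _ _ _ c => ∑ s, (c s).count l
  | inv _ _ t => t.count l

/-- The root piece is of the form `O_k : 1 → k`. -/
def StartsOp {n : ℕ} {L : Type} : TreeDiagram O W n L → Prop
  | leaf _ => False
  | op _ _ _ _ => True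
  | inv _ _ _ => False

/-- The root piece is of the form `W_1 : 1 ← 1`. -/
def StartsInv {n : ℕ} {L : Type} : TreeDiagram O W n L → Prop
  | leaf _ => False
  | op _ _ _ _ => False
  | inv _ _ _ => True

/-- Adjacent pieces point in different directions, and no column of pieces `O_1` or `W_1` is
labelled by identities only. -/
def IsReduced {n : ℕ} {L : Type} : TreeDiagram O W n L → Prop
  | leaf _ => True
  | op _ k α c => ¬ (∀ i, (⟨k, α i⟩ : Σ n, O.Op n) = ⟨1, O.one⟩) ∧
      ∀ s, ¬ (c s).StartsOp ∧ (c s).IsReduced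
  | inv _ w t => ¬ (∀ i, w i = 1) ∧ ¬ t.StartsInv ∧ t.IsReduced

/-- Delete and repeat rows along a monotone map of the sets of rows, and graft the tree `f l` onto
each leaf with label `l`. -/
def subst {m n : ℕ} {L L' : Type} (θ : Fin (m + 1) →o Fin (n + 1))
    (f : L → TreeDiagram O W m L') : TreeDiagram O W n L → TreeDiagram O W m L'
  | leaf l => f l
  | op v k α c => op (v.reindex θ) k (fun i => α (θ i)) (fun s => (c s).subst θ f)
  | inv v w t => inv (v.reindex θ) (fun i => w (θ i)) (t.subst θ f)

/-- Deleting and repeating rows. -/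
def reindex {m n : ℕ} {L : Type} (θ : Fin (m + 1) →o Fin (n + 1)) (t : TreeDiagram O W n L) :
    TreeDiagram O W m L :=
  t.subst θ leaf

/-- Grafting the tree `f l` onto the leaf labelled `l`, for each label `l`. -/
def graft {n : ℕ} {L L' : Type} (t : TreeDiagram O W n L) (f : L → TreeDiagram O W n L') :
    TreeDiagram O W n L' :=
  t.subst OrderHom.id f

/-- Relabelling the leaves. -/
def relabel {n : ℕ} {L L' : Type} (e : L → L') (t : TreeDiagram O W n L) : TreeDiagram O W n L' :=
  t.graft fun l => leaf (e l)

/-- A tree viewed as a column of operations with its children: its root piece, if that is of the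
form `O_k : 1 → k`, and a column of identities otherwise. -/
def toNode {n : ℕ} {L : Type} : TreeDiagram O W n L → Node O n (TreeDiagram O W n L)
  | leaf l => Node.pure (leaf l)
  | op _ k α c => ⟨k, α, c⟩
  | inv v w t => Node.pure (inv v w t)

open Classical in
/-- The tree with root piece the given column, unless that contains only identities. -/
noncomputable def consOp {n : ℕ} {L : Type} (v : Chain W n)
    (p : Node O n (TreeDiagram O W n L)) : TreeDiagram O W n L :=
  if h : p.IsIdentity then h.only else op v p.arity p.op p.child

open Classical in
/-- The tree with root piece the given column, unless that contains only identities. -/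
noncomputable def consInv {n : ℕ} {L : Type} (v : Chain W n) (w : Fin (n + 1) → W)
    (t : TreeDiagram O W n L) : TreeDiagram O W n L :=
  if ∀ i, w i = 1 then t else inv v w t

/-- Put a column of pieces `O_k : 1 → k` below reduced trees, and reduce: compose it with all
adjacent pieces of this form, and delete the result if it contains only identities. -/
noncomputable def pushOp {n : ℕ} {L : Type} (v : Chain W n)
    (p : Node O n (TreeDiagram O W n L)) : TreeDiagram O W n L :=
  consOp v (p.bind toNode)

/-- Put a column of pieces `W_1 : 1 ← 1` below a reduced tree, and reduce. -/
noncomputable def pushInv {n : ℕ} {L : Type} (v : Chain W n) (w : Fin (n + 1) → W)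
    (t : TreeDiagram O W n L) : TreeDiagram O W n L :=
  match t with
  | leaf l => consInv v w (leaf l)
  | op v' k α c => consInv v w (op v' k α c)
  | inv _ w' t' => consInv v (fun i => w' i * w i) t'

/-- The reduced form: compose adjacent columns pointing in the same direction and delete columns of
identities, until this is no longer possible. -/
noncomputable def reduce {n : ℕ} {L : Type} : TreeDiagram O W n L → TreeDiagram O W n L
  | leaf l => leaf l
  | op v k α c => pushOp v ⟨k, α, fun s => (c s).reduce⟩
  | inv v w t => pushInv v w t.reduce

/-! Reduction is well defined and compatible with the operations. -/

section Lemmas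

variable {n : ℕ} {L L' L'' : Type}

/-- The commutativity condition for a column with root chain `v`. -/
def NodeComm (v : Chain W n) (p : Node O n (TreeDiagram O W n L)) : Prop :=
  ∀ (i j : Fin (n + 1)) (h : i ≤ j),
    O.comp ⟨p.arity, p.op i⟩ (fun s => ⟨1, ((p.child s).rootChain.hom h : O.Op 1)⟩) =
      O.comp ⟨1, (v.hom h : O.Op 1)⟩ (fun _ => ⟨p.arity, p.op j⟩)

theorem nodeComm_pure (t : TreeDiagram O W n L) : NodeComm t.rootChain (Node.pure t) :=
  fun _ _ _ => (O.one_comp _).trans (O.comp_one _).symm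

theorem nodeComm_toNode {t : TreeDiagram O W n L} (ht : t.IsCommutative) :
    NodeComm t.rootChain t.toNode := by
  cases t with
  | leaf l => exact nodeComm_pure _
  | op v k α c => exact ht.1
  | inv v w t => exact nodeComm_pure _

theorem NodeComm.bind {v : Chain W n} {p : Node O n (TreeDiagram O W n L)} (hp : NodeComm v p)
    {f : TreeDiagram O W n L → Node O n (TreeDiagram O W n L')}
    (hf : ∀ s, NodeComm (p.child s).rootChain (f (p.child s))) : NodeComm v (p.bind f) := by
  intro i j h
  have h1 := O.comp_assoc ⟨p.arity, p.op i⟩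
    (fun s => ⟨(f (p.child s)).arity, (f (p.child s)).op i⟩)
    (fun s t => ⟨1, (((f (p.child s)).child t).rootChain.hom h : O.Op 1)⟩)
  have h2 := O.comp_assoc ⟨p.arity, p.op i⟩
    (fun s => ⟨1, ((p.child s).rootChain.hom h : O.Op 1)⟩)
    (fun s _ => ⟨(f (p.child s)).arity, (f (p.child s)).op j⟩)
  have h3 := O.comp_assoc ⟨1, (v.hom h : O.Op 1)⟩ (fun _ => ⟨p.arity, p.op j⟩)
    (fun _ s => ⟨(f (p.child s)).arity, (f (p.child s)).op j⟩)
  have key : ∀ {q q' : Σ n, O.Op n} (e : q = q') (g : Fin q.1 → Σ n, O.Op n)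
      (g' : Fin q'.1 → Σ n, O.Op n)
      (_ : ∀ s, g s = g' (Fin.cast (congrArg Sigma.fst e) s)), O.comp q g = O.comp q' g' := by
    rintro q _ rfl g g' hg
    rw [show g = g' from funext hg]
  refine h1.trans ?_
  refine (congrArg (O.comp ⟨p.arity, p.op i⟩) (funext fun s => hf s i j h)).trans ?_
  refine h2.symm.trans (Eq.trans ?_ h3)
  refine key (hp i j h) _ _ fun s => ?_
  have e1 : ∀ y : Σ _ : Fin p.arity, Fin 1, (finSigmaFinEquiv y : ℕ) = y.1 :=
    Node.val_finSigmaFinEquiv_const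
  have e2 : ∀ y : Σ _ : Fin 1, Fin p.arity, (finSigmaFinEquiv y : ℕ) = y.2 :=
    finSigmaFinEquiv_one
  have aux : ∀ (s : Fin (∑ _ : Fin p.arity, 1)) (s' : Fin (∑ _ : Fin 1, p.arity)),
      (s : ℕ) = s' → (finSigmaFinEquiv.symm s).1 = (finSigmaFinEquiv.symm s').2 := by
    intro s s' hs
    refine Fin.ext ?_
    rw [← e1, ← e2, Equiv.apply_symm_apply, Equiv.apply_symm_apply, hs]
  have := aux s (Fin.cast (congrArg Sigma.fst (hp i j h)) s) rfl
  exact congrArg (fun s => (⟨(f (p.child s)).arity, (f (p.child s)).op j⟩ : Σ n, O.Op n)) this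

theorem NodeComm.rootChain_only {v : Chain W n} {p : Node O n (TreeDiagram O W n L)}
    (hp : NodeComm v p) (h : p.IsIdentity) : h.only.rootChain = v := by
  have key : ∀ t : TreeDiagram O W n L, NodeComm v (Node.pure t) → t.rootChain = v := by
    intro t ht
    ext i j hij
    have := ht i j hij
    exact O.sigma_inj ((O.one_comp _).symm.trans (this.trans (O.comp_one _)))
  rw [h.eq_pure] at hp
  exact key _ hp

theorem consOp_pure (v : Chain W n) (t : TreeDiagram O W n L) : consOp v (Node.pure t) = t :=
  dif_pos (Node.isIdentity_pure t)

theorem consOp_of_not {v : Chain W n} {p : Node O n (TreeDiagram O W n L)}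
    (h : ¬ p.IsIdentity) : consOp v p = op v p.arity p.op p.child :=
  dif_neg h

theorem toNode_of_not {t : TreeDiagram O W n L} (h : ¬ t.StartsOp) : t.toNode = Node.pure t := by
  cases t with
  | leaf l => rfl
  | op v k α c => exact absurd trivial h
  | inv v w t => rfl

theorem child_toNode {t : TreeDiagram O W n L} (h : t.IsReduced) (s) :
    ¬ (t.toNode.child s).StartsOp ∧ (t.toNode.child s).IsReduced := by
  cases t with
  | leaf l => exact ⟨fun h => h, trivial⟩
  | op v k α c => exact h.2 s
  | inv v w t => exact ⟨fun h => h, h⟩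

theorem consOp_toNode {t : TreeDiagram O W n L} (h : t.IsReduced) :
    consOp t.rootChain t.toNode = t := by
  cases t with
  | leaf l => exact consOp_pure _ _
  | op v k α c => exact consOp_of_not h.1
  | inv v w t => exact consOp_pure _ _

theorem toNode_consOp {v : Chain W n} {p : Node O n (TreeDiagram O W n L)}
    (h : ∀ s, ¬ (p.child s).StartsOp) : (consOp v p).toNode = p := by
  by_cases hp : p.IsIdentity
  · rw [hp.eq_pure, consOp_pure]
    exact toNode_of_not (h _)
  · rw [consOp_of_not hp]
    rfl

theorem consOp_isReduced {v : Chain W n} {p : Node O n (TreeDiagram O W n L)}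
    (h : ∀ s, ¬ (p.child s).StartsOp ∧ (p.child s).IsReduced) : (consOp v p).IsReduced := by
  by_cases hp : p.IsIdentity
  · rw [consOp, dif_pos hp]
    exact (h _).2
  · rw [consOp_of_not hp]
    exact ⟨hp, h⟩

theorem pushOp_isReduced {v : Chain W n} {p : Node O n (TreeDiagram O W n L)}
    (h : ∀ s, (p.child s).IsReduced) : (pushOp v p).IsReduced :=
  consOp_isReduced fun _ => child_toNode (h _) _

theorem consInv_isReduced {v : Chain W n} {w : Fin (n + 1) → W} {t : TreeDiagram O W n L}
    (hs : ¬ t.StartsInv) (h : t.IsReduced) : (consInv v w t).IsReduced := by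
  by_cases hw : ∀ i, w i = 1
  · rwa [consInv, if_pos hw]
  · rw [consInv, if_neg hw]
    exact ⟨hw, hs, h⟩

theorem pushInv_isReduced {v : Chain W n} {w : Fin (n + 1) → W} {t : TreeDiagram O W n L}
    (h : t.IsReduced) : (pushInv v w t).IsReduced := by
  cases t with
  | leaf l => exact consInv_isReduced (fun h => h) h
  | op v k α c => exact consInv_isReduced (fun h => h) h
  | inv v w t => exact consInv_isReduced h.2.1 h.2.2

theorem pushInv_of_not {v : Chain W n} {w : Fin (n + 1) → W} {t : TreeDiagram O W n L}
    (h : ¬ t.StartsInv) : pushInv v w t = consInv v w t := by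
  cases t with
  | leaf l => rfl
  | op v k α c => rfl
  | inv v w t => exact absurd trivial h

theorem reduce_isReduced (t : TreeDiagram O W n L) : t.reduce.IsReduced := by
  induction t with
  | leaf l => trivial
  | op v k α c ih => exact pushOp_isReduced ih
  | inv v w t ih => exact pushInv_isReduced ih

theorem reduce_eq_self {t : TreeDiagram O W n L} (h : t.IsReduced) : t.reduce = t := by
  induction t with
  | leaf l => rfl
  | op v k α c ih =>
    have h1 : (fun s => (c s).reduce) = c := funext fun s => ih s (h.2 s).2
    have h2 : (⟨k, α, c⟩ : Node O n (TreeDiagram O W n L)).bind toNode = ⟨k, α, c⟩ := by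
      have : (⟨k, α, c⟩ : Node O n (TreeDiagram O W n L)).bind toNode =
          (⟨k, α, c⟩ : Node O n (TreeDiagram O W n L)).bind Node.pure := by
        have e : (fun s => (c s).toNode) = fun s => Node.pure (c s) :=
          funext fun s => toNode_of_not (h.2 s).1
        exact congrArg (fun f : Fin k → Node O n (TreeDiagram O W n L) =>
          (⟨k, α, f⟩ : Node O n (Node O n (TreeDiagram O W n L))).bind fun x => x) e
      rw [this, Node.bind_pure]
    rw [reduce, h1, pushOp, h2]
    exact consOp_of_not h.1
  | inv v w t ih =>
    rw [reduce, ih h.2.2, pushInv_of_not h.2.1, consInv, if_neg h.1]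

theorem pushInv_one {t : TreeDiagram O W n L} (h : t.IsReduced) {w : Fin (n + 1) → W}
    (hw : ∀ i, w i = 1) : pushInv t.rootChain w t = t := by
  cases t with
  | leaf l => exact if_pos hw
  | op v k α c => exact if_pos hw
  | inv v w' t =>
    have : (fun i => w' i * w i) = w' := funext fun i => by rw [hw i, mul_one]
    show consInv v (fun i => w' i * w i) t = _
    rw [this, consInv, if_neg h.1]

theorem pushInv_mul {t : TreeDiagram O W n L} (h : t.IsReduced) (v v' : Chain W n)
    (w w' : Fin (n + 1) → W) :
    pushInv v (fun i => w' i * w i) t = pushInv v w (pushInv v' w' t) := by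
  have key : ∀ {t : TreeDiagram O W n L} (_ : ¬ t.StartsInv) (w' : Fin (n + 1) → W),
      consInv v (fun i => w' i * w i) t = pushInv v w (consInv v' w' t) := by
    intro t ht w'
    by_cases hw : ∀ i, w' i = 1
    · have : (fun i => w' i * w i) = w := funext fun i => by rw [hw i, one_mul]
      rw [this, consInv.eq_1 v' w', if_pos hw, pushInv_of_not ht]
    · rw [consInv.eq_1 v' w', if_neg hw]
      rfl
  cases t with
  | leaf l => exact key (t := leaf l) (fun h => h) _
  | op v₀ k α c => exact key (t := op v₀ k α c) (fun h => h) _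
  | inv v'' w'' t =>
    refine Eq.trans ?_ (key h.2.1 _)
    show consInv v _ t = _
    congr 1
    funext i
    exact (mul_assoc _ _ _).symm

/-! Root chains and commutativity. -/

theorem rootChain_consOp {v : Chain W n} {p : Node O n (TreeDiagram O W n L)}
    (hp : NodeComm v p) : (consOp v p).rootChain = v := by
  by_cases h : p.IsIdentity
  · rw [consOp, dif_pos h]
    exact hp.rootChain_only h
  · rw [consOp_of_not h]
    rfl

theorem consOp_isCommutative {v : Chain W n} {p : Node O n (TreeDiagram O W n L)}
    (hp : NodeComm v p) (hc : ∀ s, (p.child s).IsCommutative) : (consOp v p).IsCommutative := by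
  by_cases h : p.IsIdentity
  · rw [consOp, dif_pos h]
    exact hc _
  · rw [consOp_of_not h]
    exact ⟨hp, hc⟩

theorem child_toNode_comm {t : TreeDiagram O W n L} (h : t.IsCommutative) (s) :
    (t.toNode.child s).IsCommutative := by
  cases t with
  | leaf l => trivial
  | op v k α c => exact h.2 s
  | inv v w t => exact h

theorem NodeComm.bind_toNode {v : Chain W n} {p : Node O n (TreeDiagram O W n L)}
    (hp : NodeComm v p) (hc : ∀ s, (p.child s).IsCommutative) : NodeComm v (p.bind toNode) :=
  hp.bind fun s => nodeComm_toNode (hc s)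

theorem rootChain_pushOp {v : Chain W n} {p : Node O n (TreeDiagram O W n L)}
    (hp : NodeComm v p) (hc : ∀ s, (p.child s).IsCommutative) : (pushOp v p).rootChain = v :=
  rootChain_consOp (hp.bind_toNode hc)

theorem pushOp_isCommutative {v : Chain W n} {p : Node O n (TreeDiagram O W n L)}
    (hp : NodeComm v p) (hc : ∀ s, (p.child s).IsCommutative) : (pushOp v p).IsCommutative :=
  consOp_isCommutative (hp.bind_toNode hc) fun _ => child_toNode_comm (hc _) _

/-- The commutativity condition for a column of pieces `W_1 : 1 ← 1`. -/
def InvComm (v : Chain W n) (w : Fin (n + 1) → W) (t : TreeDiagram O W n L) : Prop :=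
  ∀ (i j : Fin (n + 1)) (h : i ≤ j), w i * v.hom h = t.rootChain.hom h * w j

theorem InvComm.rootChain_eq {v : Chain W n} {w : Fin (n + 1) → W} {t : TreeDiagram O W n L}
    (h : InvComm v w t) (hw : ∀ i, w i = 1) : t.rootChain = v := by
  ext i j hij
  have := h i j hij
  rw [hw, hw, one_mul, mul_one] at this
  exact congrArg Subtype.val this.symm

theorem InvComm.mul {v v' : Chain W n} {w w' : Fin (n + 1) → W} {t : TreeDiagram O W n L}
    (h : InvComm v w (inv v' w' t)) (h' : InvComm v' w' t) :
    InvComm v (fun i => w' i * w i) t := by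
  intro i j hij
  have e1 : w i * v.hom hij = v'.hom hij * w j := h i j hij
  rw [mul_assoc, e1, ← mul_assoc, h' i j hij, mul_assoc]

theorem consInv_comm {v : Chain W n} {w : Fin (n + 1) → W} {t : TreeDiagram O W n L}
    (h : InvComm v w t) (ht : t.IsCommutative) :
    (consInv v w t).rootChain = v ∧ (consInv v w t).IsCommutative := by
  by_cases hw : ∀ i, w i = 1
  · rw [consInv, if_pos hw]
    exact ⟨h.rootChain_eq hw, ht⟩
  · rw [consInv, if_neg hw]
    exact ⟨rfl, h, ht⟩

theorem pushInv_comm {v : Chain W n} {w : Fin (n + 1) → W} {t : TreeDiagram O W n L}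
    (h : InvComm v w t) (ht : t.IsCommutative) :
    (pushInv v w t).rootChain = v ∧ (pushInv v w t).IsCommutative := by
  cases t with
  | leaf l => exact consInv_comm h ht
  | op v' k α c => exact consInv_comm h ht
  | inv v' w' t => exact consInv_comm (h.mul ht.1) ht.2

theorem nodeComm_congr {v : Chain W n} {k : ℕ} {α : Fin (n + 1) → O.Op k}
    {c c' : Fin k → TreeDiagram O W n L} (h : NodeComm v ⟨k, α, c⟩)
    (hc : ∀ s, (c' s).rootChain = (c s).rootChain) : NodeComm v ⟨k, α, c'⟩ := by
  intro i j hij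
  have := h i j hij
  dsimp only at this ⊢
  simp only [hc]
  exact this

theorem reduce_comm {t : TreeDiagram O W n L} (h : t.IsCommutative) :
    t.reduce.rootChain = t.rootChain ∧ t.reduce.IsCommutative := by
  induction t with
  | leaf l => exact ⟨rfl, trivial⟩
  | op v k α c ih =>
    have hp : NodeComm v ⟨k, α, fun s => (c s).reduce⟩ :=
      nodeComm_congr (c := c) h.1 fun s => (ih s (h.2 s)).1
    exact ⟨rootChain_pushOp hp fun s => (ih s (h.2 s)).2,
      pushOp_isCommutative hp fun s => (ih s (h.2 s)).2⟩
  | inv v w t ih =>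
    obtain ⟨e, ih⟩ := ih h.2
    exact pushInv_comm (fun i j hij => (h.1 i j hij).trans (by rw [e])) ih

/-- A family of trees that may be grafted: commutative, with identities as root chains. -/
def Graftable (f : L → TreeDiagram O W n L') : Prop :=
  ∀ l, (f l).rootChain = Chain.triv n ∧ (f l).IsCommutative

theorem graftable_leaf (e : L → L') : Graftable (O := O) (W := W) (n := n) fun l => leaf (e l) :=
  fun _ => ⟨rfl, trivial⟩

theorem graftable_leaf_id : Graftable (O := O) (W := W) (n := n) (leaf : L → _) :=
  fun _ => ⟨rfl, trivial⟩

variable {m : ℕ} (θ : Fin (m + 1) →o Fin (n + 1))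

theorem subst_comm {f : L → TreeDiagram O W m L'} (hf : Graftable f) {t : TreeDiagram O W n L}
    (h : t.IsCommutative) :
    (t.subst θ f).rootChain = t.rootChain.reindex θ ∧ (t.subst θ f).IsCommutative := by
  induction t with
  | leaf l => exact hf l
  | op v k α c ih =>
    refine ⟨rfl, fun i j hij => ?_, fun s => (ih s (h.2 s)).2⟩
    have := h.1 (θ i) (θ j) (θ.monotone hij)
    simp only [(ih _ (h.2 _)).1]
    exact this
  | inv v w t ih =>
    refine ⟨rfl, fun i j hij => ?_, (ih h.2).2⟩
    rw [(ih h.2).1]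
    exact h.1 (θ i) (θ j) (θ.monotone hij)

theorem subst_subst {l : ℕ} (φ : Fin (l + 1) →o Fin (m + 1)) (f : L → TreeDiagram O W m L')
    (g : L' → TreeDiagram O W l L'') (t : TreeDiagram O W n L) :
    (t.subst θ f).subst φ g = t.subst (θ.comp φ) (fun x => (f x).subst φ g) := by
  induction t with
  | leaf l => rfl
  | op v k α c ih => simp only [subst, ih]; rfl
  | inv v w t ih => simp only [subst, ih]; rfl

theorem subst_id_leaf (t : TreeDiagram O W n L) : t.subst OrderHom.id leaf = t := by
  induction t with
  | leaf l => rfl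
  | op v k α c ih => simp only [subst, ih]; rfl
  | inv v w t ih => simp only [subst, ih]; rfl

theorem reindex_relabel (e : L → L') (t : TreeDiagram O W n L) :
    (t.relabel e).reindex θ = (t.reindex θ).relabel e := by
  have h := subst_subst θ OrderHom.id (leaf : L → TreeDiagram O W m L)
    (fun l => (leaf (e l) : TreeDiagram O W m L')) t
  exact (subst_subst OrderHom.id θ _ _ t).trans h.symm

theorem bind_congr' {X Y : Type u} (p : Node O n X) {f g : X → Node O n Y}
    (h : ∀ s, f (p.child s) = g (p.child s)) : p.bind f = p.bind g :=
  congrArg (fun F : Fin p.arity → Node O n Y => (⟨p.arity, p.op, F⟩ : Node O n _).bind fun x => x)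
    (funext h)

theorem subst_pushOp {f : L → TreeDiagram O W m L'} (hf : Graftable f) {v : Chain W n}
    {p : Node O n (TreeDiagram O W n L)} (hp : NodeComm v p)
    (hc : ∀ s, (p.child s).IsCommutative) :
    ((pushOp v p).subst θ f).reduce =
      pushOp (v.reindex θ) (p.map θ fun t => (t.subst θ f).reduce) := by
  set g : TreeDiagram O W n L → TreeDiagram O W m L' := fun t => (t.subst θ f).reduce with hg
  have hgr : ∀ t, (g t).IsReduced := fun t => reduce_isReduced _
  have star : ∀ t : TreeDiagram O W n L, (g t).toNode = (t.toNode.map θ g).bind toNode := by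
    intro t
    cases t with
    | leaf l => exact (Node.pure_bind (g (leaf l)) toNode).symm
    | op v k α c => exact toNode_consOp fun s => (child_toNode (hgr _) _).1
    | inv v w t => exact (Node.pure_bind (g (inv v w t)) toNode).symm
  have main : (p.map θ g).bind toNode = ((p.bind toNode).map θ g).bind toNode := by
    have h1 : (p.bind toNode).map θ g =
        (p.map θ fun t => t).bind (fun t => t.toNode.map θ g) := rfl
    rw [h1, Node.bind_assoc]
    have h2 : (p.map θ g).bind toNode = (p.map θ fun t => t).bind (fun t => (g t).toNode) := rfl
    rw [h2]
    exact bind_congr' _ fun s => star _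
  rw [pushOp.eq_1 (v.reindex θ), main]
  by_cases hi : (p.bind toNode).IsIdentity
  · have hpc := hp.bind_toNode hc
    rw [pushOp, consOp, dif_pos hi]
    have hroot := hpc.rootChain_only hi
    have hcomm : hi.only.IsCommutative := child_toNode_comm (hc _) _
    have e := hi.eq_pure
    generalize hi.only = c at e hroot hcomm
    rw [e]
    show g c = consOp (v.reindex θ) ((Node.pure (g c)).bind toNode)
    rw [Node.pure_bind]
    have : v.reindex θ = (g c).rootChain := by
      have hs := subst_comm θ hf hcomm
      rw [hg, (reduce_comm hs.2).1, hs.1, hroot]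
    rw [this, consOp_toNode (hgr c)]
  · rw [pushOp, consOp_of_not hi]
    rfl

theorem subst_pushInv {f : L → TreeDiagram O W m L'} (hf : Graftable f) {v : Chain W n}
    {w : Fin (n + 1) → W} {t : TreeDiagram O W n L} (h : InvComm v w t) (ht : t.IsCommutative) :
    ((pushInv v w t).subst θ f).reduce =
      pushInv (v.reindex θ) (fun i => w (θ i)) (t.subst θ f).reduce := by
  have key : ∀ {w : Fin (n + 1) → W} {t : TreeDiagram O W n L} (_ : InvComm v w t)
      (_ : t.IsCommutative), ((consInv v w t).subst θ f).reduce =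
      pushInv (v.reindex θ) (fun i => w (θ i)) (t.subst θ f).reduce := by
    intro w t h ht
    by_cases hw : ∀ i, w i = 1
    · rw [consInv, if_pos hw]
      have hs := subst_comm θ hf ht
      have : v.reindex θ = (t.subst θ f).reduce.rootChain := by
        rw [(reduce_comm hs.2).1, hs.1, h.rootChain_eq hw]
      rw [this]
      exact (pushInv_one (reduce_isReduced _) fun i => hw (θ i)).symm
    · rw [consInv, if_neg hw]
      rfl
  cases t with
  | leaf l => exact key h ht
  | op v' k α c => exact key h ht
  | inv v' w' t =>
    refine (key (h.mul ht.1) ht.2).trans ?_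
    exact pushInv_mul (reduce_isReduced _) (v.reindex θ) (v'.reindex θ) (fun i => w (θ i))
      (fun i => w' (θ i))

theorem reduce_subst_reduce {f : L → TreeDiagram O W m L'} (hf : Graftable f)
    {t : TreeDiagram O W n L} (h : t.IsCommutative) :
    (t.reduce.subst θ f).reduce = (t.subst θ f).reduce := by
  induction t with
  | leaf l => rfl
  | op v k α c ih =>
    have hc := fun s => reduce_comm (h.2 s)
    have hp : NodeComm v ⟨k, α, fun s => (c s).reduce⟩ :=
      nodeComm_congr (c := c) h.1 fun s => (hc s).1
    rw [reduce, subst_pushOp θ hf hp fun s => (hc s).2]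
    show pushOp _ ⟨k, _, fun s => ((c s).reduce.subst θ f).reduce⟩ =
      pushOp _ ⟨k, _, fun s => ((c s).subst θ f).reduce⟩
    simp only [ih _ (h.2 _)]
  | inv v w t ih =>
    have hc := reduce_comm h.2
    rw [reduce, subst_pushInv θ hf (fun i j hij => (h.1 i j hij).trans (by rw [hc.1])) hc.2,
      ih h.2]
    rfl

theorem reduce_subst_family (f : L → TreeDiagram O W m L') (t : TreeDiagram O W n L) :
    (t.subst θ fun l => (f l).reduce).reduce = (t.subst θ f).reduce := by
  induction t with
  | leaf l => exact reduce_eq_self (reduce_isReduced _)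
  | op v k α c ih => simp only [subst, reduce, ih]
  | inv v w t ih => simp only [subst, reduce, ih]

theorem relabel_isReduced (e : L → L') {t : TreeDiagram O W n L} (h : t.IsReduced) :
    (t.relabel e).IsReduced := by
  have hs : ∀ t : TreeDiagram O W n L, ((t.relabel e).StartsOp ↔ t.StartsOp) ∧
      ((t.relabel e).StartsInv ↔ t.StartsInv) := by
    intro t
    cases t <;> exact ⟨Iff.rfl, Iff.rfl⟩
  induction t with
  | leaf l => trivial
  | op v k α c ih => exact ⟨h.1, fun s => ⟨fun h' => (h.2 s).1 ((hs _).1.1 h'), ih s (h.2 s).2⟩⟩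
  | inv v w t ih => exact ⟨h.1, fun h' => h.2.1 ((hs _).2.1 h'), ih h.2.2⟩

theorem relabel_reduce (e : L → L') {t : TreeDiagram O W n L} (h : t.IsCommutative) :
    t.reduce.relabel e = (t.relabel e).reduce := by
  rw [← reduce_eq_self (relabel_isReduced e (reduce_isReduced t))]
  exact reduce_subst_reduce _ (graftable_leaf e) h

/-! Labels. -/

variable [DecidableEq L] [DecidableEq L']

theorem count_toNode (l : L) (t : TreeDiagram O W n L) :
    ∑ s, (t.toNode.child s).count l = t.count l := by
  cases t with
  | leaf l' => exact Fin.sum_univ_one _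
  | op v k α c => rfl
  | inv v w t => exact Fin.sum_univ_one _

theorem count_consOp (l : L) (v : Chain W n) (p : Node O n (TreeDiagram O W n L)) :
    (consOp v p).count l = ∑ s, (p.child s).count l := by
  by_cases h : p.IsIdentity
  · rw [h.eq_pure, consOp_pure]
    exact (Fin.sum_univ_one fun s => ((Node.pure h.only).child s).count l).symm
  · rw [consOp_of_not h]
    rfl

theorem count_pushOp (l : L) (v : Chain W n) (p : Node O n (TreeDiagram O W n L)) :
    (pushOp v p).count l = ∑ s, (p.child s).count l := by
  rw [pushOp, count_consOp]
  refine (sum_blocks fun s t => (((p.child s).toNode.child t).count l)).trans ?_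
  exact Finset.sum_congr rfl fun s _ => count_toNode l _

theorem count_consInv (l : L) (v : Chain W n) (w : Fin (n + 1) → W) (t : TreeDiagram O W n L) :
    (consInv v w t).count l = t.count l := by
  by_cases h : ∀ i, w i = 1
  · rw [consInv, if_pos h]
  · rw [consInv, if_neg h]
    rfl

theorem count_pushInv (l : L) (v : Chain W n) (w : Fin (n + 1) → W) (t : TreeDiagram O W n L) :
    (pushInv v w t).count l = t.count l := by
  cases t <;> exact count_consInv _ _ _ _

theorem count_reduce (l : L) (t : TreeDiagram O W n L) : t.reduce.count l = t.count l := by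
  induction t with
  | leaf _ => rfl
  | op v k α c ih =>
    rw [reduce, count_pushOp]
    exact Finset.sum_congr rfl fun s _ => ih s
  | inv v w t ih => rw [reduce, count_pushInv, ih]; rfl

theorem count_subst [Fintype L] (f : L → TreeDiagram O W m L') (l' : L')
    (t : TreeDiagram O W n L) :
    (t.subst θ f).count l' = ∑ l, t.count l * (f l).count l' := by
  induction t with
  | leaf l => simp [subst, count]
  | op v k α c ih =>
    simp only [subst, count, ih, Finset.sum_mul]
    exact Finset.sum_comm
  | inv v w t ih => exact ih

theorem count_relabel [Fintype L] (e : L → L') (l' : L') (t : TreeDiagram O W n L) :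
    (t.relabel e).count l' = ∑ l, if e l = l' then t.count l else 0 := by
  rw [relabel, graft, count_subst]
  exact Finset.sum_congr rfl fun l _ => by simp [count]

end Lemmas

end TreeDiagram

end Trees


section TreeLocalization

variable (O : SetOperad.{u}) (W : Submonoid (O.Op 1))

/-- The reduced tree hammocks of height `n` with `k` labelled leaves: reduced commutative diagrams
of `n + 1` copies of a planar tree, in which each of the labels `0, …, k - 1` occurs exactly once
and the vertical arrows at the root (as at the labelled leaves) are identities. -/
@[ext]
structure TreeHammock (n k : ℕ) where
  tree : TreeDiagram O W n (Fin k)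
  rootChain : tree.rootChain = Chain.triv n
  comm : tree.IsCommutative
  reduced : tree.IsReduced
  count (l : Fin k) : tree.count l = 1

variable {O W}

namespace TreeHammock

open TreeDiagram

variable {n : ℕ}

/-- The reduced form of a tree hammock. -/
noncomputable def ofDiagram {k : ℕ} (t : TreeDiagram O W n (Fin k))
    (hr : t.rootChain = Chain.triv n) (hc : t.IsCommutative) (hl : ∀ l, t.count l = 1) :
    TreeHammock O W n k where
  tree := t.reduce
  rootChain := (reduce_comm hc).1.trans hr
  comm := (reduce_comm hc).2
  reduced := reduce_isReduced t
  count l := (count_reduce l t).trans (hl l)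

/-- The tree that consists of a single node. -/
def unit (n : ℕ) : TreeHammock O W n 1 where
  tree := leaf 0
  rootChain := rfl
  comm := trivial
  reduced := trivial
  count _ := if_pos (Subsingleton.elim _ _)

theorem graftable {k : ℕ} (x : TreeHammock O W n k) {L : Type} (e : Fin k → L) :
    (x.tree.relabel e).rootChain = Chain.triv n ∧ (x.tree.relabel e).IsCommutative := by
  have := subst_comm OrderHom.id (graftable_leaf e) x.comm
  exact ⟨this.1.trans x.rootChain, this.2⟩

/-- The action of a bijection by relabelling the leaves: the leaf of `x` with label `e s` receives
the label `s`. -/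
def act {m k : ℕ} (e : Fin m ≃ Fin k) (x : TreeHammock O W n k) : TreeHammock O W n m where
  tree := x.tree.relabel e.symm
  rootChain := (graftable x _).1
  comm := (graftable x _).2
  reduced := relabel_isReduced _ x.reduced
  count l := by
    rw [count_relabel, Finset.sum_eq_single (e l)]
    · rw [if_pos (e.symm_apply_apply l), x.count]
    · intro s _ hs
      exact if_neg fun h => hs (by rw [← h, e.apply_symm_apply])
    · intro h
      exact absurd (Finset.mem_univ _) h

/-- The labels of the composite `γ (x; y₁, …, y_k)` before reduction: the trees `y s` are grafted
onto the leaves of `x`, and their leaves are labelled consecutively. -/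
def graftAll {k : ℕ} {j : Fin k → ℕ} (x : TreeHammock O W n k)
    (y : ∀ s, TreeHammock O W n (j s)) : TreeDiagram O W n (Fin (∑ s, j s)) :=
  x.tree.graft fun s => (y s).tree.relabel fun t => finSigmaFinEquiv ⟨s, t⟩

/-- The operad composition: grafting of trees, followed by reduction. -/
noncomputable def comp {k : ℕ} {j : Fin k → ℕ} (x : TreeHammock O W n k)
    (y : ∀ s, TreeHammock O W n (j s)) : TreeHammock O W n (∑ s, j s) :=
  ofDiagram (graftAll x y)
    ((subst_comm OrderHom.id (fun s => graftable (y s) _) x.comm).1.trans x.rootChain)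
    (subst_comm OrderHom.id (fun s => graftable (y s) _) x.comm).2
    (fun l => by
      obtain ⟨⟨s, t⟩, rfl⟩ := finSigmaFinEquiv.surjective l
      have h : ∀ s', (((y s').tree.relabel fun t => finSigmaFinEquiv ⟨s', t⟩).count
          (finSigmaFinEquiv ⟨s, t⟩)) = if s' = s then 1 else 0 := by
        intro s'
        rw [count_relabel]
        by_cases hs : s' = s
        · subst hs
          rw [if_pos rfl, Finset.sum_eq_single t]
          · rw [if_pos rfl, (y s').count]
          · intro t' _ ht
            refine if_neg fun h => ht ?_
            have := finSigmaFinEquiv.injective h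
            exact eq_of_heq (Sigma.mk.inj this).2
          · intro h
            exact absurd (Finset.mem_univ _) h
        · rw [if_neg hs]
          refine Finset.sum_eq_zero fun t' _ => if_neg fun h => hs ?_
          exact congrArg Sigma.fst (finSigmaFinEquiv.injective h)
      rw [graftAll, graft, count_subst]
      simp only [h, x.count, one_mul]
      simp)

/-- Deleting and repeating planes, followed by reduction. -/
noncomputable def reindex {m k : ℕ} (θ : Fin (m + 1) →o Fin (n + 1)) (x : TreeHammock O W n k) :
    TreeHammock O W m k :=
  ofDiagram (x.tree.reindex θ)
    ((subst_comm θ graftable_leaf_id x.comm).1.trans (by rw [x.rootChain]; rfl))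
    (subst_comm θ graftable_leaf_id x.comm).2
    (fun l => by
      rw [TreeDiagram.reindex, count_subst, Finset.sum_eq_single l]
      · rw [x.count, one_mul]
        exact if_pos rfl
      · intro s _ hs
        rw [x.count, one_mul]
        exact if_neg hs
      · intro h
        exact absurd (Finset.mem_univ _) h)

theorem sigma_ext {k l : ℕ} {x : TreeHammock O W n k} {y : TreeHammock O W n l} (h : k = l)
    (e : x.tree.relabel (Fin.cast h) = y.tree) :
    (⟨k, x⟩ : Σ k, TreeHammock O W n k) = ⟨l, y⟩ := by
  subst h
  have : x = y := TreeHammock.ext ((subst_id_leaf x.tree).symm.trans e)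
  rw [this]

theorem relabel_relabel {L L' L'' : Type} (e : L → L') (e' : L' → L'')
    (t : TreeDiagram O W n L) : (t.relabel e).relabel e' = t.relabel fun l => e' (e l) :=
  subst_subst _ _ _ _ _

theorem graft_relabel {L L' L'' : Type} (e : L → L') (f : L' → TreeDiagram O W n L'')
    (t : TreeDiagram O W n L) : (t.relabel e).graft f = t.graft fun l => f (e l) :=
  subst_subst _ _ _ _ _

theorem relabel_graft {L L' L'' : Type} (e : L' → L'') (f : L → TreeDiagram O W n L')
    (t : TreeDiagram O W n L) : (t.graft f).relabel e = t.graft fun l => (f l).relabel e :=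
  subst_subst _ _ _ _ _

theorem graft_graft {L L' L'' : Type} (g : L' → TreeDiagram O W n L'')
    (f : L → TreeDiagram O W n L') (t : TreeDiagram O W n L) :
    (t.graft f).graft g = t.graft fun l => (f l).graft g :=
  subst_subst _ _ _ _ _

theorem graftAll_comm {k : ℕ} {j : Fin k → ℕ} (x : TreeHammock O W n k)
    (y : ∀ s, TreeHammock O W n (j s)) : (graftAll x y).IsCommutative :=
  (subst_comm OrderHom.id (fun s => graftable (y s) _) x.comm).2

theorem comp_assoc {k : ℕ} {j : Fin k → ℕ} {i : ∀ s, Fin (j s) → ℕ} (x : TreeHammock O W n k)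
    (y : ∀ s, TreeHammock O W n (j s)) (z : ∀ s t, TreeHammock O W n (i s t)) :
    (⟨_, comp (comp x y) (fun p => z (finSigmaFinEquiv.symm p).1 (finSigmaFinEquiv.symm p).2)⟩ :
      Σ n', TreeHammock O W n n') = ⟨_, comp x (fun s => comp (y s) (z s))⟩ := by
  refine sigma_ext (sum_blocks i) ?_
  have hl : ((comp (comp x y) (fun p => z (finSigmaFinEquiv.symm p).1
      (finSigmaFinEquiv.symm p).2)).tree) = (graftAll (comp x y) (fun p =>
      z (finSigmaFinEquiv.symm p).1 (finSigmaFinEquiv.symm p).2)).reduce := rfl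
  rw [hl, relabel_reduce _ (graftAll_comm _ _)]
  have h1 : (graftAll (comp x y) (fun p => z (finSigmaFinEquiv.symm p).1
      (finSigmaFinEquiv.symm p).2)).relabel (Fin.cast (sum_blocks i)) =
      (graftAll x y).reduce.graft fun p =>
        (z (finSigmaFinEquiv.symm p).1 (finSigmaFinEquiv.symm p).2).tree.relabel fun c =>
          finSigmaFinEquiv ⟨(finSigmaFinEquiv.symm p).1,
            finSigmaFinEquiv ⟨(finSigmaFinEquiv.symm p).2, c⟩⟩ := by
    rw [graftAll, relabel_graft]
    simp only [relabel_relabel, block_assoc]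
    rfl
  rw [h1]
  let Z : (Σ s, Fin (j s)) → TreeDiagram O W n (Fin (∑ s, ∑ t, i s t)) := fun p =>
    (z p.1 p.2).tree.relabel fun c => finSigmaFinEquiv ⟨p.1, finSigmaFinEquiv ⟨p.2, c⟩⟩
  have h2 : ((graftAll x y).reduce.graft fun p => Z (finSigmaFinEquiv.symm p)).reduce =
      ((graftAll x y).graft fun p => Z (finSigmaFinEquiv.symm p)).reduce :=
    reduce_subst_reduce _ (fun p => graftable (z _ _) _) (graftAll_comm x y)
  refine h2.trans ?_
  have h3 : ((graftAll x y).graft fun p => Z (finSigmaFinEquiv.symm p)) =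
      x.tree.graft fun s => (y s).tree.graft fun t => Z ⟨s, t⟩ := by
    rw [graftAll, graft_graft]
    simp only [graft_relabel, Equiv.symm_apply_apply]
  rw [h3]
  have h4 : ∀ s, ((comp (y s) (z s)).tree.relabel fun c => finSigmaFinEquiv ⟨s, c⟩) =
      ((y s).tree.graft fun t => Z ⟨s, t⟩).reduce := by
    intro s
    have e : (comp (y s) (z s)).tree = (graftAll (y s) (z s)).reduce := rfl
    rw [e, relabel_reduce _ (graftAll_comm _ _), graftAll, relabel_graft]
    simp only [relabel_relabel]
    rfl
  have h5 : (comp x (fun s => comp (y s) (z s))).tree =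
      (x.tree.graft fun s => (comp (y s) (z s)).tree.relabel fun c =>
        finSigmaFinEquiv ⟨s, c⟩).reduce := rfl
  rw [h5]
  simp only [h4]
  exact (reduce_subst_family OrderHom.id _ _).symm

theorem unit_comp {k : ℕ} (x : TreeHammock O W n k) :
    (⟨_, comp (unit n) (fun _ => x)⟩ : Σ k, TreeHammock O W n k) = ⟨k, x⟩ := by
  refine sigma_ext (Fin.sum_univ_one fun _ => k) ?_
  have h : (comp (unit n) (fun _ : Fin 1 => x)).tree = (x.tree.relabel fun t =>
      (finSigmaFinEquiv ⟨0, t⟩ : Fin (∑ _ : Fin 1, k))) :=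
    reduce_eq_self (relabel_isReduced _ x.reduced)
  rw [h, relabel_relabel]
  refine Eq.trans ?_ (subst_id_leaf x.tree)
  exact congrArg x.tree.relabel (funext fun t => Fin.ext (finSigmaFinEquiv_one (⟨0, t⟩ : Σ _ : Fin 1, Fin k)))

theorem comp_unit {k : ℕ} (x : TreeHammock O W n k) :
    (⟨_, comp x (fun _ => unit n)⟩ : Σ k, TreeHammock O W n k) = ⟨k, x⟩ := by
  refine sigma_ext (by simp) ?_
  have h : (comp x (fun _ => unit n)).tree = (x.tree.relabel fun s =>
      (finSigmaFinEquiv ⟨s, 0⟩ : Fin (∑ _ : Fin k, 1))) :=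
    reduce_eq_self (relabel_isReduced _ x.reduced)
  rw [h, relabel_relabel]
  refine Eq.trans ?_ (subst_id_leaf x.tree)
  exact congrArg x.tree.relabel (funext fun t =>
    Fin.ext (Node.val_finSigmaFinEquiv_const (⟨t, 0⟩ : Σ _ : Fin k, Fin 1)))

theorem comp_tree {k : ℕ} {j : Fin k → ℕ} (x : TreeHammock O W n k)
    (y : ∀ s, TreeHammock O W n (j s)) : (comp x y).tree = (graftAll x y).reduce := rfl

theorem act_comp {m k : ℕ} (e : Fin m ≃ Fin k) {j : Fin m → ℕ} (x : TreeHammock O W n k)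
    (y : ∀ s, TreeHammock O W n (j s)) :
    comp (act e x) y = act (blockEquiv e j) (comp x (fun t => y (e.symm t))) := by
  refine TreeHammock.ext ?_
  show (graftAll (act e x) y).reduce = (graftAll x _).reduce.relabel _
  rw [relabel_reduce _ (graftAll_comm _ _), graftAll, graftAll, relabel_graft]
  simp only [relabel_relabel]
  congr 1
  refine (graft_relabel _ _ _).trans ?_
  congr 1
  funext t
  congr 1
  funext c
  simp only [blockEquiv, Equiv.symm_trans_apply, Equiv.symm_symm, Equiv.symm_apply_apply]
  rfl

theorem comp_act {k : ℕ} {i j : Fin k → ℕ} (x : TreeHammock O W n k)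
    (τ : ∀ s, Fin (i s) ≃ Fin (j s)) (y : ∀ s, TreeHammock O W n (j s)) :
    comp x (fun s => act (τ s) (y s)) = act (sumEquiv τ) (comp x y) := by
  refine TreeHammock.ext ?_
  show (graftAll x _).reduce = (graftAll x y).reduce.relabel _
  rw [relabel_reduce _ (graftAll_comm _ _), graftAll, graftAll, relabel_graft]
  simp only [relabel_relabel]
  congr 2
  funext s
  refine (relabel_relabel _ _ _).trans ?_
  congr 1
  funext c
  simp only [sumEquiv, Equiv.symm_trans_apply, Equiv.symm_symm, Equiv.symm_apply_apply]
  rfl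

theorem reindex_act {m k l : ℕ} (θ : Fin (m + 1) →o Fin (n + 1)) (e : Fin l ≃ Fin k)
    (x : TreeHammock O W n k) : (act e x).reindex θ = act e (x.reindex θ) := by
  refine TreeHammock.ext ?_
  show (TreeDiagram.reindex θ (x.tree.relabel e.symm)).reduce =
    (TreeDiagram.reindex θ x.tree).reduce.relabel e.symm
  refine Eq.trans ?_ (relabel_reduce e.symm (subst_comm θ graftable_leaf_id x.comm).2).symm
  exact congrArg _ (reindex_relabel θ e.symm x.tree)

theorem reindex_comp {m k : ℕ} {j : Fin k → ℕ} (θ : Fin (m + 1) →o Fin (n + 1))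
    (x : TreeHammock O W n k) (y : ∀ s, TreeHammock O W n (j s)) :
    (comp x y).reindex θ = comp (x.reindex θ) (fun s => (y s).reindex θ) := by
  refine TreeHammock.ext ?_
  show (TreeDiagram.reindex θ (graftAll x y).reduce).reduce =
    ((TreeDiagram.reindex θ x.tree).reduce.graft fun s =>
      (TreeDiagram.reindex θ (y s).tree).reduce.relabel _).reduce
  refine (reduce_subst_reduce θ graftable_leaf_id (graftAll_comm x y)).trans ?_
  have hy : ∀ s, ((TreeDiagram.reindex θ (y s).tree).reduce.relabel fun t =>
      (finSigmaFinEquiv ⟨s, t⟩ : Fin (∑ s, j s))) =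
      ((TreeDiagram.reindex θ (y s).tree).relabel fun t => finSigmaFinEquiv ⟨s, t⟩).reduce :=
    fun s => relabel_reduce _ (subst_comm θ graftable_leaf_id (y s).comm).2
  simp only [hy]
  symm
  refine (reduce_subst_family OrderHom.id _ _).trans ?_
  refine (reduce_subst_reduce OrderHom.id (fun s => ?_)
    (subst_comm θ graftable_leaf_id x.comm).2).trans ?_
  · have h1 := subst_comm θ graftable_leaf_id (y s).comm
    have h2 := subst_comm OrderHom.id (graftable_leaf fun t =>
      (finSigmaFinEquiv ⟨s, t⟩ : Fin (∑ s, j s))) h1.2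
    refine ⟨h2.1.trans ?_, h2.2⟩
    rw [h1.1, (y s).rootChain]
    rfl
  · refine congrArg _ ?_
    have h := subst_subst θ OrderHom.id (leaf : Fin k → TreeDiagram O W m (Fin k)) (fun s =>
      (TreeDiagram.reindex θ (y s).tree).relabel fun t =>
        (finSigmaFinEquiv ⟨s, t⟩ : Fin (∑ s, j s))) x.tree
    refine h.trans (Eq.trans ?_ (subst_subst OrderHom.id θ _ _ x.tree).symm)
    refine congrArg (fun f => x.tree.subst θ f) (funext fun s => ?_)
    exact (reindex_relabel θ _ (y s).tree).symm

theorem reindex_nat_id {k : ℕ} (x : TreeHammock O W n k) : x.reindex OrderHom.id = x :=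
  TreeHammock.ext ((congrArg _ (subst_id_leaf x.tree)).trans (reduce_eq_self x.reduced))

theorem reindex_nat_comp {l m k : ℕ} (θ : Fin (m + 1) →o Fin (n + 1))
    (φ : Fin (l + 1) →o Fin (m + 1)) (x : TreeHammock O W n k) :
    x.reindex (θ.comp φ) = (x.reindex θ).reindex φ := by
  refine TreeHammock.ext (Eq.symm ?_)
  refine (reduce_subst_reduce φ graftable_leaf_id
    (subst_comm θ graftable_leaf_id x.comm).2).trans ?_
  exact congrArg _ (subst_subst _ _ _ _ _)

end TreeHammock

variable (O W)

/-- The `n`-simplices of the tree hammock localization, as an operad in sets. -/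
noncomputable def treeHammockOperad (n : ℕ) : SetOperad.{u} where
  Op := TreeHammock O W n
  one := TreeHammock.unit n
  act := TreeHammock.act
  γ := TreeHammock.comp
  act_refl x := TreeHammock.ext (TreeDiagram.subst_id_leaf x.tree)
  act_trans e f x := TreeHammock.ext
    (TreeHammock.relabel_relabel f.symm e.symm x.tree).symm
  γ_assoc := TreeHammock.comp_assoc
  one_γ := TreeHammock.unit_comp
  γ_one := TreeHammock.comp_unit
  act_γ := TreeHammock.act_comp
  γ_act := TreeHammock.comp_act

/-- The tree hammock localization `L^{TH}_W O`, a simplicial object in operads: its `n`-simplices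
in arity `k` are the reduced tree hammocks of height `n` with `k` labelled leaves. -/
noncomputable def treeHammockLocalization : SimplicialObject SetOperad.{u} where
  obj n := treeHammockOperad O W n.unop.len
  map θ :=
    { map := TreeHammock.reindex θ.unop.toOrderHom
      map_one := rfl
      map_act := TreeHammock.reindex_act _
      map_γ := TreeHammock.reindex_comp _ }
  map_id _ := SetOperad.Hom.ext (funext fun _ => funext fun x => TreeHammock.reindex_nat_id x)
  map_comp f g := SetOperad.Hom.ext (funext fun _ => funext fun x =>
    TreeHammock.reindex_nat_comp f.unop.toOrderHom g.unop.toOrderHom x)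

end TreeLocalization

/-! ### The hammock localization of a monoid -/

/-- The one-object category of a monoid `M`; the composite of `f` followed by `g` is `f * g`. -/
def OneObject (_M : Type u) : Type := Unit

/-- The object of the one-object category of `M`. -/
def OneObject.star (M : Type u) : OneObject M := ()

instance (M : Type u) [Monoid M] : Category.{u} (OneObject M) where
  Hom _ _ := M
  id _ := 1
  comp f g := (show M from f) * (show M from g)
  id_comp := one_mul
  comp_id := mul_one
  assoc := mul_assoc

/-- The subcategory of the one-object category of `M` given by a submonoid. -/
def submonoidArrows {M : Type u} [Monoid M] (W : Submonoid M) :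
    MorphismProperty (OneObject M) :=
  fun _ _ f => (show M from f) ∈ W

instance {M : Type u} [Monoid M] (W : Submonoid M) : (submonoidArrows W).IsMultiplicative where
  id_mem _ := W.one_mem
  comp_mem _ _ hf hg := W.mul_mem hf hg

/-- The hammock localization `L^H_W M` of a monoid, viewed as a category with one object: a
simplicial monoid. -/
noncomputable def hammockLocalization {M : Type u} [Monoid M] (W : Submonoid M) :
    SimplicialObject MonCat.{u} :=
  hammockEnd (submonoidArrows W) (OneObject.star M)

end HammockLocalization

namespace HammockLocalization

section Comparison

variable {M : Type u} [Monoid M]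

/-! A tree hammock of arity one over `M₊` is a zigzag. Since `M₊` has no operation of arity at least
two, no piece with two or more outgoing nodes can be labelled, so the tree does not branch. A piece
`O_0` would end this unbranched tree without a labelled leaf, whereas the label of arity one must
occur once. What remains is a string of pieces `O_1` and `W_1` from the root to the leaf. Reading
`O_1` as a column pointing to the right and `W_1` as a column pointing to the left gives a hammock.
The two notions of commutativity become the same equations in `M`: `α b = v α'` for a column to the
right and `w v = b w'` for a column to the left. The identities at root and leaf are the identities
at the two ends of the hammock.

The translation is `Hammock.toTree`, defined by recursion on all hammocks, reduced or not.
`Hammock.toTree_injective` and `Hammock.exists_toTree_eq` make it bijective onto the commutative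
trees with one labelled leaf, once both ends are fixed; the second is the one place where the shape
of `M₊` excludes other trees. `Hammock.isReduced_toTree` restricts this to the reduced diagrams.

The structure is compared before reduction: concatenation of hammocks is grafting onto the only leaf
(`Hammock.toTree_append`), and rows are deleted and repeated column by column on both sides
(`Hammock.toTree_reindex`). Both reductions are the same recursion, which pushes one column at a
time onto a reduced diagram, so they commute with the translation (`Hammock.toTree_reduce`). Hence
products and simplicial operators agree. -/

/-- The element of `M` underlying an arrow of the one-object category of `M`. -/
def OneObject.elt {a b : OneObject M} (f : a ⟶ b) : M := f

theorem OneObject.elt_eqToHom {a b : OneObject M} (e : a = b) : elt (eqToHom e) = (1 : M) := by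
  subst e
  rfl

/-! ### Elements of `M` and `W` as unary operations of `M₊` -/

variable {W : Submonoid M}

/-- The elements of `W`, as one-ary operations of `M₊`. -/
abbrev plusSubmonoid (W : Submonoid M) : Submonoid ((plusOperad M).Op 1) :=
  W.map (plusUnary M)

/-- An element of `W`, as a one-ary operation of `M₊`. -/
def plusElt (a : M) (h : a ∈ W) : plusSubmonoid W :=
  ⟨plusUnary M a, ⟨a, h, rfl⟩⟩

theorem plusElt_mul (a b : M) (ha : a ∈ W) (hb : b ∈ W) (hab : a * b ∈ W) :
    plusElt (a * b) hab = plusElt a ha * plusElt b hb :=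
  Subtype.ext (map_mul (plusUnary M) a b)

theorem plusElt_inj {a b : M} {ha : a ∈ W} {hb : b ∈ W} (h : plusElt a ha = plusElt b hb) :
    a = b :=
  (plusUnary M).injective (congrArg Subtype.val h)

theorem exists_plusElt (w : plusSubmonoid W) : ∃ a, ∃ h : a ∈ W, plusElt a h = w := by
  obtain ⟨_, a, h, rfl⟩ := w
  exact ⟨a, h, rfl⟩

/-- The composite has arity `∑ _ : Fin 1, p.1`, which is not literally `p.1`; hence the formulation
with pairs of an arity and an operation. Over `M₊` such a pair is determined by its underlying
element of `Option M`, and that is what is compared. -/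
theorem plus_comp_unary (a : M) (p : Σ n, PlusOp M n) :
    (plusOperad M).comp ⟨1, plusUnary M a⟩ (fun _ => p) = ⟨p.1, p.2.smul a⟩ :=
  PlusOp.val_inj ((PlusOp.val_γ_some (x := PlusOp.of a) (fun _ => p.2) rfl 0).trans
    (PlusOp.val_smul a p.2).symm)

/-- This turns operadic composition of unary operations into multiplication in `M`; it serves for
the composition of adjacent columns as well as for the commutativity of pieces `O_1`. -/
theorem plus_comp_mul (a b : M) :
    (plusOperad M).comp ⟨1, plusUnary M a⟩ (fun _ => ⟨1, plusUnary M b⟩) =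
      ⟨1, plusUnary M (a * b)⟩ :=
  plus_comp_unary a ⟨1, plusUnary M b⟩

/-! ### Vertical chains as functors and as families of elements -/

/-- The vertical chain of a tree hammock given by a vertical chain of a hammock. -/
def VertChain.toChain {n : ℕ} (X : VertChain (submonoidArrows W) n) :
    Chain (plusSubmonoid W) n where
  hom h := plusElt (OneObject.elt (X.toFunctor.map (homOfLE h))) (X.mem _)
  hom_refl i := Subtype.ext (congrArg (plusUnary M) (X.toFunctor.map_id i))
  hom_trans h h' := Subtype.ext ((congrArg (plusUnary M)
    (X.toFunctor.map_comp (homOfLE h) (homOfLE h'))).trans (map_mul (plusUnary M) _ _))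

/-- Supplies the hypothesis on the end chain in the lemmas below, which are stated for a variable
end chain so that induction on hammocks applies. -/
theorem VertChain.toChain_const (n : ℕ) :
    (VertChain.const (W := submonoidArrows W) n (OneObject.star M)).toChain = Chain.triv n :=
  rfl

/-- There is only one object, so a functor is determined by its values on arrows, and every arrow of
the poset of rows comes from an inequality. Injectivity is needed because the intermediate chains of
a hammock are indices of its type, while a tree records them only as data at its nodes. -/
theorem VertChain.toChain_injective {n : ℕ} :
    Function.Injective (VertChain.toChain (W := W) (n := n)) := by
  rintro ⟨F, hF⟩ ⟨G, hG⟩ h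
  have e : F = G := by
    refine CategoryTheory.Functor.ext (fun _ => rfl) fun i j f => ?_
    have hf : f = homOfLE (leOfHom f) := Subsingleton.elim _ _
    have := (plusUnary M).injective
      (congrArg (fun c : Chain (plusSubmonoid W) n =>
        (c.hom (leOfHom f) : (plusOperad M).Op 1)) h)
    rw [hf]
    refine Eq.trans (b := G.map (homOfLE (leOfHom f))) this ?_
    -- Equality of functors is stated up to composition with `eqToHom` on both sides; here these are
    -- the unit of `M`.
    exact ((Category.id_comp _).trans (Category.comp_id (G.map (homOfLE (leOfHom f))))).symm
  subst e
  rfl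

/-- The two laws of a chain are the functor laws for a functor that is constant on objects. -/
theorem VertChain.toChain_surjective {n : ℕ} :
    Function.Surjective (VertChain.toChain (W := W) (n := n)) := by
  intro c
  refine ⟨⟨{ obj := fun _ => OneObject.star M
             map := fun f => (plusUnary M).symm (c.hom (leOfHom f))
             map_id := fun i => ?_
             map_comp := fun f g => ?_ }, fun f => ?_⟩, ?_⟩
  · exact congrArg (fun x : plusSubmonoid W => (plusUnary M).symm x) (c.hom_refl i)
  · exact (congrArg (fun x : plusSubmonoid W => (plusUnary M).symm x)
      (c.hom_trans (leOfHom f) (leOfHom g))).trans (map_mul (plusUnary M).symm _ _)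
  · obtain ⟨a, ha, e⟩ := exists_plusElt (c.hom (leOfHom f))
    show (plusUnary M).symm (c.hom (leOfHom f) : (plusOperad M).Op 1) ∈ W
    rw [← e]
    exact ha
  · rfl

variable {n : ℕ}

/-! ### From hammocks to linear trees -/

/-- The linear tree diagram given by a hammock. -/
def Hammock.toTree {X Y : VertChain (submonoidArrows W) n} :
    Hammock (submonoidArrows W) n X Y → TreeDiagram (plusOperad M) (plusSubmonoid W) n (Fin 1)
  -- The end chain is forgotten here, since a leaf always carries identities. This is why later
  -- statements assume that the end chain is trivial.
  | nil _ => .leaf 0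
  | right (X := X) f h =>
      .op X.toChain 1 (fun i => plusUnary M (OneObject.elt (f.app i))) fun _ => h.toTree
  | left (X := X) f hf h =>
      .inv X.toChain (fun i => plusElt (OneObject.elt (f.app i)) (hf i)) h.toTree

namespace Hammock

variable {X Y Z : VertChain (submonoidArrows W) n}

/-- All objects coincide, so the equality of objects demanded in each row is automatic and its
`eqToHom` is the unit. The next two lemmas express the resulting condition in the forms by which
columns of trees are deleted. -/
theorem isIdentityColumn_iff (f : X.toFunctor ⟶ Y.toFunctor) :
    IsIdentityColumn f ↔ ∀ i, OneObject.elt (f.app i) = 1 := by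
  refine forall_congr' fun i => ⟨?_, fun h => ⟨rfl, h⟩⟩
  rintro ⟨e, h⟩
  rw [h, OneObject.elt_eqToHom]

theorem isIdentityColumn_iff_op (f : X.toFunctor ⟶ Y.toFunctor) :
    IsIdentityColumn f ↔ ∀ i, (⟨1, plusUnary M (OneObject.elt (f.app i))⟩ :
      Σ n, (plusOperad M).Op n) = ⟨1, (plusOperad M).one⟩ := by
  rw [isIdentityColumn_iff]
  refine forall_congr' fun i => ⟨fun h => by rw [h]; rfl, fun h => ?_⟩
  exact (plusUnary M).injective ((plusOperad M).sigma_inj h)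

theorem isIdentityColumn_iff_inv (f : Y.toFunctor ⟶ X.toFunctor)
    (hf : ∀ i, submonoidArrows W (f.app i)) :
    IsIdentityColumn f ↔ ∀ i, plusElt (OneObject.elt (f.app i)) (hf i) = 1 := by
  rw [isIdentityColumn_iff]
  refine forall_congr' fun i => ⟨fun h => ?_, fun h => ?_⟩
  · exact Subtype.ext (congrArg (plusUnary M) h)
  · exact (plusUnary M).injective (congrArg Subtype.val h)

theorem startsRight_iff (h : Hammock (submonoidArrows W) n X Y) :
    h.toTree.StartsOp ↔ h.StartsRight := by
  cases h <;> exact Iff.rfl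

theorem startsLeft_iff (h : Hammock (submonoidArrows W) n X Y) :
    h.toTree.StartsInv ↔ h.StartsLeft := by
  cases h <;> exact Iff.rfl

theorem isReduced_toTree (h : Hammock (submonoidArrows W) n X Y) :
    h.toTree.IsReduced ↔ h.IsReduced := by
  induction h with
  | nil => exact Iff.rfl
  | right f h ih =>
    refine and_congr (not_congr (isIdentityColumn_iff_op f).symm) ?_
    rw [← ih, ← startsRight_iff]
    -- The condition on the children of the piece is a condition on its only child.
    exact ⟨fun h => h 0, fun h _ => h⟩
  | left f hf h ih =>
    refine and_congr (not_congr (isIdentityColumn_iff_inv f hf).symm) ?_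
    rw [← ih, ← startsLeft_iff]

/-! ### Concatenation and change of rows -/

/-- The leaf of the first tree forgets the chain at the gluing point, and the root node of the
second tree supplies it again. Hence no condition on the chains is needed. -/
theorem toTree_append (h : Hammock (submonoidArrows W) n X Y)
    (k : Hammock (submonoidArrows W) n Y Z) :
    (h.append k).toTree = h.toTree.graft fun _ => k.toTree := by
  induction h with
  | nil => rfl
  | right f h ih => simp only [append, toTree, ih]; rfl
  | left f hf h ih => simp only [append, toTree, ih]; rfl

theorem toTree_reindex {m : ℕ} (θ : Fin (m + 1) →o Fin (n + 1))
    (h : Hammock (submonoidArrows W) n X Y) : (h.reindex θ).toTree = h.toTree.reindex θ := by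
  induction h with
  | nil => rfl
  | right f h ih => simp only [reindex, toTree, ih]; rfl
  | left f hf h ih => simp only [reindex, toTree, ih]; rfl

/-! ### Compatibility with reduction -/

theorem toTree_consRight (f : X.toFunctor ⟶ Y.toFunctor)
    (h : Hammock (submonoidArrows W) n Y Z) :
    (consRight f h).toTree = TreeDiagram.consOp X.toChain
      ⟨1, fun i => plusUnary M (OneObject.elt (f.app i)), fun _ => h.toTree⟩ := by
  have hi : IsIdentityColumn f ↔ Node.IsIdentity (⟨1, fun i => plusUnary M
      (OneObject.elt (f.app i)), fun _ => h.toTree⟩ : Node (plusOperad M) n _) :=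
    isIdentityColumn_iff_op f
  by_cases hf : IsIdentityColumn f
  -- Deleting the column of a hammock involves a transport along the equality of its two chains. It
  -- disappears once the chains are identified, and both sides are then the tree of the rest.
  · replace hi := hi.1 hf
    obtain rfl := hf.eq
    obtain rfl := hf.eq_id
    rw [consRight_id]
    rw [TreeDiagram.consOp, dif_pos hi]
    rfl
  · rw [consRight, dif_neg hf]
    exact (TreeDiagram.consOp_of_not fun h' => hf (hi.2 h')).symm

/-- Pushing onto a tree composes the new column with the column `toNode` of its child. This is a
column of identities when the child is a leaf or starts with `W_1`, and composing with it changes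
nothing. When the child starts with `O_1`, the composite is the column of products, as in the
hammock. -/
theorem toTree_pushRight (f : X.toFunctor ⟶ Y.toFunctor)
    (h : Hammock (submonoidArrows W) n Y Z) :
    (pushRight f h).toTree = TreeDiagram.pushOp X.toChain
      ⟨1, fun i => plusUnary M (OneObject.elt (f.app i)), fun _ => h.toTree⟩ := by
  cases h with
  | nil =>
    exact (toTree_consRight f _).trans
      (congrArg (TreeDiagram.consOp X.toChain) (Node.bind_pure _).symm)
  | left g hg h =>
    exact (toTree_consRight f _).trans
      (congrArg (TreeDiagram.consOp X.toChain) (Node.bind_pure _).symm)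
  | right g h =>
    refine (toTree_consRight (f ≫ g) h).trans
      (congrArg (TreeDiagram.consOp X.toChain) (Eq.symm ?_))
    -- The composite column has arity `∑ _ : Fin 1, 1`, so it is compared with the column of arity
    -- `1` through its arity, its operations and its children.
    exact Node.bind_ext (Fin.sum_univ_one fun _ => 1)
      (fun i => plus_comp_mul (OneObject.elt (f.app i)) (OneObject.elt (g.app i))) fun _ => rfl

theorem toTree_consLeft (f : Y.toFunctor ⟶ X.toFunctor)
    (hf : ∀ i, submonoidArrows W (f.app i)) (h : Hammock (submonoidArrows W) n Y Z) :
    (consLeft f hf h).toTree = TreeDiagram.consInv X.toChain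
      (fun i => plusElt (OneObject.elt (f.app i)) (hf i)) h.toTree := by
  by_cases hi : IsIdentityColumn f
  · have hi' := (isIdentityColumn_iff_inv f hf).1 hi
    rw [TreeDiagram.consInv, if_pos hi']
    obtain rfl := hi.eq
    obtain rfl := hi.eq_id
    rw [consLeft_id]
  · rw [consLeft, dif_neg hi, TreeDiagram.consInv, if_neg fun h =>
      hi ((isIdentityColumn_iff_inv f hf).2 h)]
    rfl

/-- Arrows to the left compose from the leaf towards the root: the column farther from the root is
the first factor, both in `g ≫ f` and in the product taken by `pushInv`. -/
theorem toTree_pushLeft (f : Y.toFunctor ⟶ X.toFunctor)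
    (hf : ∀ i, submonoidArrows W (f.app i)) (h : Hammock (submonoidArrows W) n Y Z) :
    (pushLeft f hf h).toTree = TreeDiagram.pushInv X.toChain
      (fun i => plusElt (OneObject.elt (f.app i)) (hf i)) h.toTree := by
  cases h with
  | nil => exact toTree_consLeft f hf _
  | right g h => exact toTree_consLeft f hf _
  | left g hg h =>
    refine (toTree_consLeft (g ≫ f) _ h).trans ?_
    exact congrArg (fun w => TreeDiagram.consInv X.toChain w h.toTree)
      (funext fun i => plusElt_mul _ _ (hg i) (hf i) _)

/-- Both reductions recurse over the columns and push each of them onto the reduced rest, so the two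
lemmas on pushing suffice. Neither commutativity nor a condition on the end chain enters. -/
theorem toTree_reduce (h : Hammock (submonoidArrows W) n X Y) :
    h.reduce.toTree = h.toTree.reduce := by
  induction h with
  | nil => rfl
  | right f h ih => rw [reduce, toTree_pushRight, ih]; rfl
  | left f hf h ih => rw [reduce, toTree_pushLeft, ih]; rfl

/-! ### The tree of a hammock has one leaf and commutes -/

theorem count_toTree (h : Hammock (submonoidArrows W) n X Y) (l : Fin 1) :
    h.toTree.count l = 1 := by
  induction h with
  | nil => exact if_pos (Subsingleton.elim _ _)
  | right f h ih => exact (Fin.sum_univ_one _).trans ih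
  | left f hf h ih => exact ih

theorem rootChain_toTree (h : Hammock (submonoidArrows W) n X Y)
    (hY : Y.toChain = Chain.triv n) : h.toTree.rootChain = X.toChain := by
  cases h with
  | nil => exact hY.symm
  | right f h => rfl
  | left f hf h => rfl

theorem isCommutative_toTree (h : Hammock (submonoidArrows W) n X Y)
    (hY : Y.toChain = Chain.triv n) : h.toTree.IsCommutative := by
  induction h with
  | nil => trivial
  | right f h ih =>
    refine ⟨fun i j hij => ?_, fun _ => ih hY⟩
    dsimp only
    rw [h.rootChain_toTree hY]
    refine (plus_comp_mul _ _).trans (Eq.trans ?_ (plus_comp_mul _ _).symm)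
    -- Naturality of the column from row `i` to row `j` is `v αⱼ = αᵢ b`, the required equation read
    -- from right to left.
    exact congrArg (fun a => (⟨1, plusUnary M a⟩ : Σ n, (plusOperad M).Op n))
      (f.naturality (homOfLE hij)).symm
  | left f hf h ih =>
    refine ⟨fun i j hij => ?_, ih hY⟩
    rw [h.rootChain_toTree hY]
    refine Subtype.ext ?_
    refine (map_mul (plusUnary M) _ _).symm.trans (Eq.trans ?_ (map_mul (plusUnary M) _ _))
    -- Here the column runs from the chain `b` on the leaf side to the chain `v` on the root side,
    -- so naturality is `b wⱼ = wᵢ v`.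
    exact congrArg (plusUnary M) (f.naturality (homOfLE hij)).symm

/-! ### Bijectivity of the translation -/

/-- The columns can be compared only after the intermediate chains of the two hammocks are known to
agree. Each of these is recovered from the tree as the root chain of the child; at the last step
that chain is trivial, which is where `hZ` is used. -/
theorem toTree_injective (hZ : Z.toChain = Chain.triv n)
    {h h' : Hammock (submonoidArrows W) n X Z} (e : h.toTree = h'.toTree) : h = h' := by
  induction h with
  | nil =>
    cases h' with
    | nil => rfl
    | right => cases e
    | left => cases e
  | right f h ih =>
    cases h' with
    | nil => cases e
    | left => cases e
    | right f' h' =>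
      simp only [toTree, TreeDiagram.op.injEq, heq_eq_eq, true_and] at e
      have e2 := congrFun e.2 0
      obtain rfl := VertChain.toChain_injective ((h.rootChain_toTree hZ).symm.trans
        ((congrArg _ e2).trans (h'.rootChain_toTree hZ)))
      obtain rfl : f = f' := by
        ext i
        exact (plusUnary M).injective (congrFun e.1 i)
      rw [ih hZ e2]
  | left f hf h ih =>
    cases h' with
    | nil => cases e
    | right => cases e
    | left f' hf' h' =>
      simp only [toTree, TreeDiagram.inv.injEq, true_and] at e
      obtain rfl := VertChain.toChain_injective ((h.rootChain_toTree hZ).symm.trans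
        ((congrArg _ e.2).trans (h'.rootChain_toTree hZ)))
      obtain rfl : f = f' := by
        ext i
        exact plusElt_inj (congrFun e.1 i)
      rw [ih hZ e.2]

/-- The start `X` varies in the induction because the hammock for the child starts at a new chain,
chosen over the root chain of that child. The count of the label rules out trees that end in a piece
`O_0`, and commutativity provides the naturality of each column. -/
theorem exists_toTree_eq (hZ : Z.toChain = Chain.triv n)
    (t : TreeDiagram (plusOperad M) (plusSubmonoid W) n (Fin 1)) (hc : t.IsCommutative)
    (hl : t.count 0 = 1) (X : VertChain (submonoidArrows W) n) (hX : X.toChain = t.rootChain) :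
    ∃ h : Hammock (submonoidArrows W) n X Z, h.toTree = t := by
  induction t generalizing X with
  | leaf l =>
    obtain rfl := VertChain.toChain_injective (hX.trans hZ.symm)
    exact ⟨nil _, congrArg TreeDiagram.leaf (Subsingleton.elim 0 l)⟩
  | op v k α c ih =>
    match k, α, c, ih, hc, hl with
    -- Without children the label occurs zero times.
    | 0, _, _, _, _, hl => exact absurd hl Nat.zero_ne_one
    -- Row `0` always exists, and its label would be an operation of arity at least two.
    | k + 2, α, _, _, _, _ => exact PEmpty.elim (α 0)
    | 1, α, c, ih, hc, hl =>
      obtain rfl : X.toChain = v := hX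
      obtain ⟨Y, hY⟩ := VertChain.toChain_surjective (c 0).rootChain
      obtain ⟨h, e⟩ := ih 0 (hc.2 0) ((Fin.sum_univ_one _).symm.trans hl) Y hY
      -- The children form a family over `Fin 1`; written as a constant family, they match the shape
      -- produced by `toTree` and required by `plus_comp_mul`.
      have hc0 : c = fun _ => c 0 := funext fun s => congrArg c (Subsingleton.elim s 0)
      let f : X.toFunctor ⟶ Y.toFunctor :=
        { app := fun i => (plusUnary M).symm (α i)
          naturality := fun i j g => by
            have h1 := hc.1 i j (leOfHom g)
            rw [hc0] at h1
            dsimp only at h1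
            rw [← hY] at h1
            have h2 := (plus_comp_mul (M := M) _ _).symm.trans
              (h1.trans (plus_comp_mul (M := M) _ _))
            exact ((plusUnary M).injective ((plusOperad M).sigma_inj h2)).symm }
      refine ⟨right f h, ?_⟩
      rw [hc0, ← e]
      rfl
  | inv v w t ih =>
    obtain rfl : X.toChain = v := hX
    obtain ⟨Y, hY⟩ := VertChain.toChain_surjective t.rootChain
    obtain ⟨h, e⟩ := ih hc.2 hl Y hY
    let f : Y.toFunctor ⟶ X.toFunctor :=
      { app := fun i => (plusUnary M).symm (w i)
        naturality := fun i j g => by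
          have h1 := hc.1 i j (leOfHom g)
          rw [← hY] at h1
          exact (congrArg (fun x : plusSubmonoid W => (plusUnary M).symm x) h1).symm }
    -- Labels of `W_1` lie in the image of `W` in `M₊(1)`, so the corresponding elements of `M` lie
    -- in `W`.
    have hf : ∀ i, submonoidArrows W (f.app i) := fun i => by
      obtain ⟨a, ha, ea⟩ := exists_plusElt (w i)
      show (plusUnary M).symm (w i : (plusOperad M).Op 1) ∈ W
      rw [← ea]
      exact ha
    refine ⟨left f hf h, ?_⟩
    rw [← e]
    rfl

end Hammock

/-! ### The isomorphism of simplicial monoids -/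

/-- The tree hammock of arity one given by a reduced hammock. -/
def ReducedHammock.toTreeHammock
    (h : ReducedHammock (submonoidArrows W) n (OneObject.star M) (OneObject.star M)) :
    TreeHammock (plusOperad M) (plusSubmonoid W) n 1 where
  tree := h.1.toTree
  rootChain := h.1.rootChain_toTree (VertChain.toChain_const n)
  comm := h.1.isCommutative_toTree (VertChain.toChain_const n)
  reduced := h.1.isReduced_toTree.2 h.2
  count := h.1.count_toTree

theorem ReducedHammock.toTreeHammock_bijective :
    Function.Bijective (ReducedHammock.toTreeHammock (W := W) (n := n)) := by
  refine ⟨fun h h' e => Subtype.ext (Hammock.toTree_injective (VertChain.toChain_const n)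
    (congrArg TreeHammock.tree e)), fun x => ?_⟩
  obtain ⟨h, e⟩ := Hammock.exists_toTree_eq (VertChain.toChain_const n) x.tree x.comm (x.count 0)
    (VertChain.const n (OneObject.star M)) x.rootChain.symm
  exact ⟨⟨h, h.isReduced_toTree.1 (e ▸ x.reduced)⟩, TreeHammock.ext e⟩

/-- Before reduction this is `Hammock.toTree_append`. The product of unary operations of an operad
also relabels the leaf, through `Fin (∑ _ : Fin 1, 1)` and back to `Fin 1`, and these relabellings
have to be removed. -/
theorem ReducedHammock.toTreeHammock_comp
    (h k : ReducedHammock (submonoidArrows W) n (OneObject.star M) (OneObject.star M)) :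
    (h.comp k).toTreeHammock =
      (treeHammockOperad (plusOperad M) (plusSubmonoid W) n).mul h.toTreeHammock
        k.toTreeHammock := by
  refine TreeHammock.ext ?_
  refine ((h.1.append k.1).toTree_reduce.trans (congrArg _ (h.1.toTree_append k.1))).trans ?_
  -- Any relabelling that starts and ends in `Fin 1` is the identity, whatever the intermediate set
  -- of labels.
  have hr : ∀ (L : Type) (e : L → Fin 1) (g : Fin 1 → L),
      (k.1.toTree.relabel g).relabel e = k.1.toTree := fun L e g =>
    (TreeHammock.relabel_relabel g e k.1.toTree).trans
      ((congrArg k.1.toTree.relabel (funext fun _ => Subsingleton.elim _ _)).trans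
        (TreeDiagram.subst_id_leaf k.1.toTree))
  symm
  -- The outer relabelling is moved inside the reduction, which is allowed because the grafted tree
  -- commutes, and then onto the grafted trees.
  refine (TreeDiagram.relabel_reduce _
    (TreeHammock.graftAll_comm h.toTreeHammock fun _ => k.toTreeHammock)).trans ?_
  refine congrArg _ ((TreeHammock.relabel_graft _ _ _).trans ?_)
  exact congrArg h.1.toTree.graft (funext fun _ => hr _ _ _)

theorem ReducedHammock.toTreeHammock_reindex {m : ℕ} (θ : Fin (m + 1) →o Fin (n + 1))
    (h : ReducedHammock (submonoidArrows W) n (OneObject.star M) (OneObject.star M)) :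
    (ReducedHammock.reindex θ h).toTreeHammock = h.toTreeHammock.reindex θ :=
  TreeHammock.ext ((h.1.reindex θ).toTree_reduce.trans
    (congrArg _ (h.1.toTree_reindex θ)))

/-- In each height, the reduced hammocks of `M` and the reduced tree hammocks of `M₊` of arity one
form isomorphic monoids. -/
noncomputable def reducedHammockEquiv (W : Submonoid M) (n : ℕ) :
    ReducedHammock (submonoidArrows W) n (OneObject.star M) (OneObject.star M) ≃*
      (treeHammockOperad (plusOperad M) (plusSubmonoid W) n).Op 1 where
  toEquiv := Equiv.ofBijective _ ReducedHammock.toTreeHammock_bijective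
  map_mul' := ReducedHammock.toTreeHammock_comp

end Comparison

end HammockLocalization

/-- The isomorphisms of monoids in each height are assembled into one of simplicial objects;
naturality in the monotone maps of rows is `ReducedHammock.toTreeHammock_reindex`. -/
theorem mainTheorem7 {M : Type u} [Monoid M] (W : Submonoid M) :
    Nonempty (HammockLocalization.hammockLocalization W ≅
      HammockLocalization.treeHammockLocalization (HammockLocalization.plusOperad M)
        (W.map (HammockLocalization.plusUnary M)) ⋙ HammockLocalization.SetOperad.unary) :=
  ⟨NatIso.ofComponents
    (fun n => (HammockLocalization.reducedHammockEquiv W n.unop.len).toMonCatIso) fun θ => by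
      ext h
      exact HammockLocalization.ReducedHammock.toTreeHammock_reindex θ.unop.toOrderHom h⟩
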